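/- Let $X_1,X_2,\dots$ be i.i.d. real random variables with distribution function $F$. Write $\bar F=1-F$ and let $x_F=\sup\{x\in\mathbb R: F(x)<1\}\in(-\infty,\infty]$ be the right end point. Suppose that $F$ satisfies at least one of the following three conditions. 1. There are $z<x_F$ and a measurable function $c$ with $c(x)\to c_0>0$ as $x\uparrow x_F$ such that $$\bar F(x)=c(x)\exp\Big\{-\int_z^x\frac{dt}{a(t)}\Big\}\qquad (z<x<x_F),$$ where $a$ is positive and absolutely continuous (on compact subintervals of $(z,x_F)$) with a density $a'$ satisfying $a'(x)\to0$ as $x\uparrow x_F$, and $F(x)\to1$ as $x\uparrow x_F$. 2. $F$ is in the maximal domain of attraction of the Gumbel distribution: there are $c_n>0$ and $d_n\in\mathbb R$ with $F^n(c_nx+d_n)\to\exp\{-e^{-x}\}$ for all $x\in\mathbb R$. 3. There is a positive measurable function $\beta$ such that, with $F_u(x)=P[X_1-u\le x\mid X_1>u]$ and $G_{0,\beta}(x)=1-e^{-x/\beta}$, $$\lim_{u\uparrow x_F}\ \sup_{0\le x\le x_F-u}\big|F_u(x)-G_{0,\beta(u)}(x)\big|=0$$ (the supremum is over $0\le x<\infty$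 if $x_F=\infty$). Let $k=k_n$ be a sequence of positive integers with $k_n\to\infty$ and $k_n/n\to0$. Let $X_{(1)}\ge X_{(2)}\ge\dots\ge X_{(n)}$ be the order statistics of $X_1,\dots,X_n$ and let $$\hat M(u)=\frac{\sum_{j=1}^n (X_j-u)\mathbf 1[X_j>u]}{\sum_{j=1}^n\mathbf 1[X_j>u]}$$ be the empirical mean excess function (quotients with denominator $0$ are read as $0$). Then $$\mathcal S_n:=\frac1{X_{(\lceil k/2\rceil)}-X_{(k)}}\Big\{\big(X_{(i)}-X_{(k)},\,\hat M(X_{(i)})\big):1<i\le k\Big\}\ \stackrel{P}{\longrightarrow}\ \mathcal S:=\Big\{\Big(t,\frac1{\ln 2}\Big):t\ge0\Big\}$$ as $n\to\infty$, in the space of closed subsets of $\mathbb R^2$ with the Fell topology, which is generated by the families $\{F: F\cap K=\emptyset\}$ ($K$ compact) and $\{F: F\cap G\ne\emptyset\}$ ($G$ open). That is, $P[\mathcal S_n\notin\mathcal U]\to0$ for every Fell-open neighbourhood $\mathcal U$ of $\mathcal S$. -/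

import Mathlib

open MeasureTheory ProbabilityTheory Filter Set
open scoped Topology

namespace MeanExcess

noncomputable section

/-! ### The Fell topology and convergence in probability -/

/-- The Fell (hit-and-miss) topology on the closed subsets of a topological space: it is generated
by the families `{F | F ∩ K = ∅}`, `K` compact, and `{F | F ∩ G ≠ ∅}`, `G` open. -/
abbrev fellTopology (E : Type*) [TopologicalSpace E] :
    TopologicalSpace (TopologicalSpace.Closeds E) :=
  TopologicalSpace.generateFrom
    ({U | ∃ K : Set E, IsCompact K ∧ U = {F : TopologicalSpace.Closeds E | (F : Set E) ∩ K = ∅}} ∪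
      {U | ∃ G : Set E, IsOpen G ∧ U = {F : TopologicalSpace.Closeds E | ((F : Set E) ∩ G).Nonempty}})

/-- Convergence in probability of random elements `Y n` of a topological space (whose topology is
given explicitly) to a fixed point `y`: every open neighbourhood `U` of `y` satisfies
`P (Y n ∉ U) → 0`. For any metric `d` that induces the topology this says
`P (d (Y n) y ≥ ε) → 0` for every `ε > 0`. -/
def TendstoInProbability {Ω T : Type*} [MeasurableSpace Ω] (μ : Measure Ω)
    (t : TopologicalSpace T) (Y : ℕ → Ω → T) (y : T) : Prop :=
  ∀ U : Set T, IsOpen[t] U → y ∈ U → Tendsto (fun n => μ {ω | Y n ω ∉ U}) atTop (𝓝 0)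

/-! ### The Gumbel domain of attraction -/

/-- The right end point `x_F = sup {x | F x < 1} ∈ (-∞, ∞]` of a law on the real line. -/
def rightEndpoint (ν : Measure ℝ) : EReal :=
  sSup ((fun x : ℝ => (x : EReal)) '' {x | cdf ν x < 1})

/-- The filter of real `x` that tend to the extended real `e` from below: `𝓝[<] e` for a real `e`
and `atTop` for `e = ⊤`. -/
def toLeft (e : EReal) : Filter ℝ := comap (fun x : ℝ => (x : EReal)) (𝓝[<] e)

/-- The representation `1 - F x = c x * exp (- ∫ t in z..x, 1 / a t)` on `(z, x_F)`, with `c`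
measurable, `c x → c₀ > 0`, and `a` positive and absolutely continuous with a density `a'` that
tends to `0` at `x_F`. The last clause says that `F` has no atom at `x_F` (it holds automatically
when `x_F = ∞`). -/
def HasVonMisesRepresentation (ν : Measure ℝ) : Prop :=
  ∃ (z : ℝ) (c a a' : ℝ → ℝ) (c₀ : ℝ),
    (z : EReal) < rightEndpoint ν ∧
    Measurable c ∧ 0 < c₀ ∧ Tendsto c (toLeft (rightEndpoint ν)) (𝓝 c₀) ∧
    (∀ x : ℝ, z < x → (x : EReal) < rightEndpoint ν → 0 < a x) ∧
    (∀ x y : ℝ, z < x → x ≤ y → (y : EReal) < rightEndpoint ν →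
      IntervalIntegrable a' volume x y ∧ a y - a x = ∫ t in x..y, a' t) ∧
    Tendsto a' (toLeft (rightEndpoint ν)) (𝓝 0) ∧
    (∀ x : ℝ, z < x → (x : EReal) < rightEndpoint ν →
      IntervalIntegrable (fun t => 1 / a t) volume z x ∧
      1 - cdf ν x = c x * Real.exp (-∫ t in z..x, 1 / a t)) ∧
    Tendsto (fun x => cdf ν x) (toLeft (rightEndpoint ν)) (𝓝 1)

/-- `F` is in the maximal domain of attraction of the Gumbel distribution: for some norming
constants `c n > 0` and `d n`, `F (c n * x + d n) ^ n → exp (- exp (- x))` for all real `x`. -/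
def InGumbelMaxDomain (ν : Measure ℝ) : Prop :=
  ∃ c d : ℕ → ℝ, (∀ n, 0 < c n) ∧
    ∀ x : ℝ, Tendsto (fun n => (cdf ν (c n * x + d n)) ^ n) atTop
      (𝓝 (Real.exp (-Real.exp (-x))))

/-- The excess distribution function `F_u x = P (X - u ≤ x | X > u)`, where `X` has law `ν`. -/
def excessCDF (ν : Measure ℝ) (u x : ℝ) : ℝ :=
  (ProbabilityTheory.cond ν {y | u < y}).real {y | y - u ≤ x}

/-- The generalized Pareto distribution function `G_{0,β}` with shape parameter `0` and scale
`β > 0`, at `x ≥ 0`. -/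
def gpdZero (β x : ℝ) : ℝ := 1 - Real.exp (-x / β)

/-- The approximation of excess distributions by the generalized Pareto distribution of shape `0`:
for some measurable `β > 0`, `sup {|F_u x - G_{0,β u} x| : 0 ≤ x ≤ x_F - u} → 0` as `u ↑ x_F`. -/
def HasGPDZeroApproximation (ν : Measure ℝ) : Prop :=
  ∃ β : ℝ → ℝ, Measurable β ∧ (∀ u : ℝ, (u : EReal) < rightEndpoint ν → 0 < β u) ∧
    ∀ ε : ℝ, 0 < ε → ∀ᶠ u in toLeft (rightEndpoint ν),
      ∀ x : ℝ, 0 ≤ x → ((u + x : ℝ) : EReal) ≤ rightEndpoint ν →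
        |excessCDF ν u x - gpdZero (β u) x| ≤ ε

/-! ### The mean excess plot -/

/-- The `i`-th largest value `x_(i)` of `x 0, …, x (n - 1)`, for `1 ≤ i ≤ n`
(`x_(1) ≥ x_(2) ≥ … ≥ x_(n)`); the value is `0` for other `i`. `Tuple.sort` is the permutation
that sorts increasingly. -/
def orderStat (n : ℕ) (x : ℕ → ℝ) (i : ℕ) : ℝ :=
  if h : 1 ≤ i ∧ i ≤ n then
    x (Tuple.sort (fun j : Fin n => x j) ⟨n - i, by omega⟩ : Fin n)
  else 0

/-- The empirical mean excess function of `x 0, …, x (n - 1)`: the mean of `x j - u` over the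
`j < n` with `x j > u` (and `0` if there is none). -/
def empiricalME (n : ℕ) (x : ℕ → ℝ) (u : ℝ) : ℝ :=
  (∑ j ∈ Finset.range n, if u < x j then x j - u else 0) /
    ∑ j ∈ Finset.range n, if u < x j then (1 : ℝ) else 0

/-- The scaled mean excess plot of the upper `k` order statistics of `x 0, …, x (n - 1)`:
`(x_(⌈k/2⌉) - x_(k))⁻¹ • {(x_(i) - x_(k), M̂ (x_(i))) : 1 < i ≤ k}`. -/
def mePlot (n k : ℕ) (x : ℕ → ℝ) : TopologicalSpace.Closeds (ℝ × ℝ) where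
  carrier :=
    (fun i : ℕ => (orderStat n x ⌈(k : ℝ) / 2⌉₊ - orderStat n x k)⁻¹ •
      ((orderStat n x i - orderStat n x k, empiricalME n x (orderStat n x i)) : ℝ × ℝ)) ''
      {i | 1 < i ∧ i ≤ k}
  isClosed' := ((Set.finite_Ioc 1 k).image _).isClosed

/-- The closed horizontal half-line `{(t, h) : t ≥ 0}`. -/
def horizontalHalfLine (h : ℝ) : TopologicalSpace.Closeds (ℝ × ℝ) where
  carrier := {p | ∃ t : ℝ, 0 ≤ t ∧ p = (t, h)}
  isClosed' := by
    have e : {p : ℝ × ℝ | ∃ t : ℝ, 0 ≤ t ∧ p = (t, h)} = Set.Ici 0 ×ˢ {h} := by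
      ext ⟨a, b⟩
      simp
    rw [e]
    exact isClosed_Ici.prod isClosed_singleton

end

end MeanExcess

/-! Each of the three conditions gives a tail of class Γ: survival at `w + x * β w`, divided by
survival at `w`, tends to `exp (-x)` at the right end point (`IsGammaTail`). So excesses over a high
level `w` are nearly exponential with mean `β w`. A Potter-type bound gives uniform integrability,
so the limit passes to first moments, with second moments under control.

Take a level `u` exceeded about `k` times among `n` observations, and let `b` be the scale there.
Chebyshev's inequality shows that the number of exceedances of `u + y * b`, divided by `k`, and the
total excess over it, divided by `k * b`, both tend to `exp (-y)` in probability
(`ExponentialExcesses`). Both are antitone in the level, so the limits extend to random levels.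
Inverting the counts gives `X_(i) ≈ u + b * log (k / i)`; dividing totals by counts gives an
empirical mean excess of about `b` at every such level, by lack of memory. The scaling `X_(⌈k/2⌉) -
X_(k)` is about `b * log 2`, hence the height `1 / log 2`.

In the Fell topology, hitting an open set needs one index, `i ≈ 2 ^ (-t) * k`. Missing a compact set
concerns only bounded abscissas, so the erratic points of the largest observations play no role.

Probability enters only through the filter `inProb` of events whose probability tends to one.
Ultrafilters finer than it replace almost surely convergent subsequences, which leaves a
deterministic limit argument. -/

namespace MeanExcess

noncomputable section

/-! ### Monotone families with a moving argument -/

/-- A pointwise limit of antitone functions which is continuous is attained along moving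
arguments. -/
theorem tendsto_antitone_moving {ι : Type*} {ℓ : Filter ι} {F : ι → ℝ → ℝ} {g : ℝ → ℝ} {a y₀ : ℝ}
    {y : ι → ℝ} (hF : ∀ i, Antitone (F i)) (hg : ContinuousAt g y₀)
    (hlim : ∀ t, a ≤ t → Tendsto (fun i => F i t) ℓ (𝓝 (g t)))
    (hy : Tendsto y ℓ (𝓝 y₀)) (ha : a ≤ y₀) (hay : ∀ᶠ i in ℓ, a ≤ y i) :
    Tendsto (fun i => F i (y i)) ℓ (𝓝 (g y₀)) := by
  rw [tendsto_order]
  constructor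
  · intro c hc
    have h1 : ∀ᶠ t in 𝓝 y₀, c < g t := hg.eventually_const_lt hc
    obtain ⟨δ, hδ, h⟩ := Metric.eventually_nhds_iff.1 h1
    have h2 : c < g (y₀ + δ / 2) := h (by rw [Real.dist_eq]; rw [add_sub_cancel_left, abs_of_pos (by positivity)]; linarith)
    filter_upwards [(hlim (y₀ + δ / 2) (by linarith)).eventually_const_lt h2,
      hy.eventually_lt_const (show y₀ < y₀ + δ / 2 by linarith)] with i h3 h4
    exact h3.trans_le (hF i h4.le)
  · intro c hc
    have h1 : ∀ᶠ t in 𝓝 y₀, g t < c := hg.eventually_lt_const hc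
    obtain ⟨δ, hδ, h⟩ := Metric.eventually_nhds_iff.1 h1
    -- The pointwise limit is known only from `a` on. When `y₀ = a` the test point is `a` itself,
    -- and then the assumption `a ≤ y i` is what is used.
    have h2 : g (max (y₀ - δ / 2) a) < c := h (by
      rw [Real.dist_eq, abs_lt]
      constructor
      · have := le_max_left (y₀ - δ / 2) a
        linarith
      · have : max (y₀ - δ / 2) a ≤ y₀ := max_le (by linarith) ha
        linarith)
    filter_upwards [(hlim _ (le_max_right _ _)).eventually_lt_const h2,
      hy.eventually_const_lt (show y₀ - δ / 2 < y₀ by linarith), hay] with i h3 h4 h5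
    exact (hF i (max_le h4.le h5)).trans_lt h3

/-- Generalized inverses of functions that converge to `exp (-y)` converge. -/
theorem tendsto_of_quantile {ι : Type*} {ℓ : Filter ι} {F : ι → ℝ → ℝ} {a y₀ : ℝ}
    {y θ : ι → ℝ}
    (hlim : ∀ t, a ≤ t → Tendsto (fun i => F i t) ℓ (𝓝 (Real.exp (-t))))
    (hθ : Tendsto θ ℓ (𝓝 (Real.exp (-y₀)))) (ha : a < y₀)
    (h1 : ∀ᶠ i in ℓ, ∀ t, t < y i → θ i ≤ F i t) (h2 : ∀ᶠ i in ℓ, ∀ t, y i ≤ t → F i t ≤ θ i) :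
    Tendsto y ℓ (𝓝 y₀) := by
  rw [tendsto_order]
  constructor
  · intro c hc
    have h3 : max c a < y₀ := max_lt hc ha
    have h4 := Real.exp_lt_exp.2 (neg_lt_neg h3)
    have h5 := hθ.eventually_lt (hlim _ (le_max_right c a)) h4
    filter_upwards [h5, h2] with i h5 h2
    by_contra! h
    exact absurd (h2 _ (h.trans (le_max_left _ _))) (not_le.2 h5)
  · intro c hc
    have hm : y₀ < (y₀ + c) / 2 := by linarith
    have h4 := Real.exp_lt_exp.2 (neg_lt_neg hm)
    have h5 := (hlim _ (by linarith)).eventually_lt hθ h4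
    filter_upwards [h5, h1] with i h5 h1
    by_contra! h
    exact absurd (h1 ((y₀ + c) / 2) (by linarith)) (not_le.2 h5)

/-! ### The survival function near the right end point -/

/-- The survival function `x ↦ ν (x, ∞)`. -/
def survival (ν : Measure ℝ) (x : ℝ) : ℝ := ν.real (Ioi x)

theorem survival_nonneg {ν : Measure ℝ} (x : ℝ) : 0 ≤ survival ν x := measureReal_nonneg

section Survival

variable {ν : Measure ℝ} [IsProbabilityMeasure ν]

theorem one_sub_cdf (x : ℝ) : 1 - cdf ν x = survival ν x := by
  rw [cdf_eq_real, survival, ← compl_Iic, probReal_compl_eq_one_sub measurableSet_Iic]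

theorem survival_le_one (x : ℝ) : survival ν x ≤ 1 := measureReal_le_one

theorem survival_antitone : Antitone (survival ν) := fun _ _ h =>
  measureReal_mono (Ioi_subset_Ioi h)

/-- By right-continuity, `F x < 1` persists slightly to the right of `x`, so `x` lies strictly below
the supremum. This trades extended reals for positivity of the survival function. -/
theorem lt_rightEndpoint_iff (x : ℝ) : (x : EReal) < rightEndpoint ν ↔ 0 < survival ν x := by
  rw [rightEndpoint, lt_sSup_iff]
  constructor
  · rintro ⟨_, ⟨y, hy, rfl⟩, hxy⟩
    have h1 : x < y := EReal.coe_lt_coe_iff.1 hxy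
    have h2 := survival_antitone (ν := ν) h1.le
    have h3 := one_sub_cdf (ν := ν) y
    have h4 : cdf ν y < 1 := hy
    linarith
  · intro h
    have h1 : cdf ν x < 1 := by
      have := one_sub_cdf (ν := ν) x
      linarith
    have h2 : Tendsto (cdf ν) (𝓝[>] x) (𝓝 (cdf ν x)) :=
      ((cdf ν).right_continuous x).mono Ioi_subset_Ici_self
    obtain ⟨y, hy1, hy2⟩ := ((h2.eventually_lt_const h1).and self_mem_nhdsWithin).exists
    exact ⟨y, ⟨y, hy1, rfl⟩, by exact_mod_cast hy2⟩

theorem exists_survival_pos : ∃ x, 0 < survival ν x := by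
  obtain ⟨x, hx⟩ := ((tendsto_cdf_atBot ν).eventually_lt_const zero_lt_one).exists
  exact ⟨x, by have := one_sub_cdf (ν := ν) x; linarith⟩

theorem eventually_toLeft_iff {P : ℝ → Prop} :
    (∀ᶠ w in toLeft (rightEndpoint ν), P w) ↔
      ∃ w₀, 0 < survival ν w₀ ∧ ∀ w, w₀ < w → 0 < survival ν w → P w := by
  obtain ⟨x₀, hx₀⟩ := exists_survival_pos (ν := ν)
  have h := ((nhdsLT_basis_of_exists_lt ⟨_, (lt_rightEndpoint_iff x₀).2 hx₀⟩).comap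
    (fun x : ℝ => (x : EReal))).eventually_iff (q := P)
  rw [toLeft, h]
  constructor
  · rintro ⟨b, hb, hP⟩
    obtain ⟨y, hby, hy⟩ := EReal.lt_iff_exists_real_btwn.1 hb
    exact ⟨y, (lt_rightEndpoint_iff y).1 hy, fun w hw h0 =>
      hP ⟨hby.trans (EReal.coe_lt_coe_iff.2 hw), (lt_rightEndpoint_iff w).2 h0⟩⟩
  · rintro ⟨w₀, h0, hP⟩
    exact ⟨w₀, (lt_rightEndpoint_iff w₀).2 h0, fun w hw =>
      hP w (EReal.coe_lt_coe_iff.1 hw.1) ((lt_rightEndpoint_iff w).1 hw.2)⟩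

instance toLeft_isCountablyGenerated : (toLeft (rightEndpoint ν)).IsCountablyGenerated := by
  unfold toLeft; infer_instance

theorem eventually_survival_pos : ∀ᶠ w in toLeft (rightEndpoint ν), 0 < survival ν w := by
  obtain ⟨x₀, hx₀⟩ := exists_survival_pos (ν := ν)
  exact eventually_toLeft_iff.2 ⟨x₀, hx₀, fun w _ h => h⟩

theorem eventually_gt_toLeft {w₀ : ℝ} (h : 0 < survival ν w₀) :
    ∀ᶠ w in toLeft (rightEndpoint ν), w₀ < w :=
  eventually_toLeft_iff.2 ⟨w₀, h, fun _ h _ => h⟩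

/-- If the survival function tends to `0` along positive values, its arguments tend to the right
end point. -/
theorem tendsto_toLeft_of_survival {ι : Type*} {ℓ : Filter ι} {w : ι → ℝ}
    (h0 : ∀ᶠ i in ℓ, 0 < survival ν (w i)) (h : Tendsto (fun i => survival ν (w i)) ℓ (𝓝 0)) :
    Tendsto w ℓ (toLeft (rightEndpoint ν)) := by
  intro s hs
  obtain ⟨w₀, hw₀, hP⟩ := eventually_toLeft_iff.1 hs
  rw [mem_map]
  filter_upwards [h0, h.eventually_lt_const hw₀] with i h1 h2
  refine hP _ ?_ h1
  by_contra! h3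
  exact absurd (survival_antitone (ν := ν) h3) (not_le.2 h2)

end Survival

/-! ### Tails of class `Γ` -/

/-- The survival function is of class `Γ` with auxiliary function `β`. -/
structure IsGammaTail (ν : Measure ℝ) (β : ℝ → ℝ) : Prop where
  pos : ∀ᶠ w in toLeft (rightEndpoint ν), 0 < β w
  tendsto : ∀ x, 0 ≤ x → Tendsto (fun w => survival ν (w + x * β w) / survival ν w)
    (toLeft (rightEndpoint ν)) (𝓝 (Real.exp (-x)))

namespace IsGammaTail

variable {ν : Measure ℝ} [IsProbabilityMeasure ν] {β : ℝ → ℝ}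

/-- The limit `exp (-A)` is positive, so survival at the shifted level is eventually positive: the
shift cannot pass the end point. -/
theorem tendsto_shift (h : IsGammaTail ν β) {A : ℝ} (hA : 0 ≤ A) :
    Tendsto (fun w => w + A * β w) (toLeft (rightEndpoint ν)) (toLeft (rightEndpoint ν)) := by
  intro s hs
  obtain ⟨w₀, hw₀, hP⟩ := eventually_toLeft_iff.1 hs
  rw [mem_map]
  filter_upwards [(h.tendsto A hA).eventually_const_lt (Real.exp_pos _), h.pos,
    eventually_survival_pos, eventually_gt_toLeft hw₀] with w h1 h2 h3 h4
  refine hP _ (by nlinarith) ?_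
  by_contra! h5
  exact absurd h1 (not_lt.2 (div_nonpos_of_nonpos_of_nonneg h5 h3.le))

/-- If the scale more than doubled, one unit of the new scale would cover two of the old one. A
survival ratio tending to `exp (-1)` would then be at most one tending to `exp (-2)`. -/
theorem eventually_shift_le (h : IsGammaTail ν β) {A : ℝ} (hA : 0 ≤ A) :
    ∀ᶠ w in toLeft (rightEndpoint ν), β (w + A * β w) ≤ 2 * β w := by
  have h1 := (h.tendsto 1 zero_le_one).comp (h.tendsto_shift hA)
  have h2 := (h.tendsto (A + 2) (by linarith)).div (h.tendsto A hA) (Real.exp_pos _).ne'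
  rw [← Real.exp_sub] at h2
  have h3 : Real.exp (-(A + 2) - -A) < Real.exp (-1) := Real.exp_lt_exp.2 (by linarith)
  filter_upwards [h2.eventually_lt h1 h3, (h.tendsto_shift hA).eventually eventually_survival_pos,
    eventually_survival_pos] with w h4 h5 h6
  by_contra! h7
  simp only [Function.comp_apply, Pi.div_apply, div_div_div_cancel_right₀ h6.ne'] at h4
  rw [div_lt_div_iff_of_pos_right h5] at h4
  exact absurd (survival_antitone (ν := ν) (show w + (A + 2) * β w ≤ w + A * β w +
    1 * β (w + A * β w) by linarith)) (not_le.2 h4)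

/-- Potter-type bound: excesses over high levels have tails dominated by a cubic power. -/
theorem exists_potter_bound (h : IsGammaTail ν β) :
    ∃ C, 0 ≤ C ∧ ∀ᶠ w in toLeft (rightEndpoint ν), ∀ s, 0 ≤ s →
      survival ν (w + s * β w) ≤ C * ((1 + s) ^ (-3 : ℝ)) * survival ν w := by
  -- Since `64 = 4 ^ 3`, this factor pays for replacing `s` by `s / 4` in the cubic bound.
  obtain ⟨A, hA1, hA⟩ : ∃ A : ℝ, 0 < A ∧ Real.exp (-A) < 1 / 64 := by
    refine ⟨8, by norm_num, ?_⟩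
    rw [Real.exp_neg, inv_lt_comm₀ (Real.exp_pos _) (by norm_num)]
    have h1 : Real.exp 8 = Real.exp 1 ^ 8 := by rw [← Real.exp_nat_mul]; norm_num
    have h2 : (2 : ℝ) < Real.exp 1 := by have := Real.exp_one_gt_d9; linarith
    rw [h1]
    calc (1 / 64 : ℝ)⁻¹ < 2 ^ 8 := by norm_num
      _ ≤ Real.exp 1 ^ 8 := by gcongr
  obtain ⟨w₀, hw₀, hP⟩ := eventually_toLeft_iff.1
    ((h.eventually_shift_le hA1.le).and <| h.pos.and <|
      ((h.tendsto A hA1.le).eventually_lt_const hA).and <|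
        (h.tendsto_shift hA1.le).eventually eventually_survival_pos)
  have key : ∀ n : ℕ, ∀ w, w₀ < w → 0 < survival ν w → ∀ s, 0 ≤ s → s ≤ 2 * A * 4 ^ n →
      s ^ 3 * survival ν (w + s * β w) ≤ (2 * A) ^ 3 * survival ν w := by
    intro n
    induction n with
    | zero =>
      intro w hw hs s hs0 hs1
      obtain ⟨-, hb, -, -⟩ := hP w hw hs
      have := survival_antitone (ν := ν) (show w ≤ w + s * β w by nlinarith)
      have h0 := survival_nonneg (ν := ν) (w + s * β w)
      have : s ≤ 2 * A := by simpa using hs1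
      gcongr
    | succ n ih =>
      intro w hw hs s hs0 hs1
      obtain ⟨h1, hb, h2, h3⟩ := hP w hw hs
      rcases le_or_gt s (2 * A) with hsA | hsA
      · have := survival_antitone (ν := ν) (show w ≤ w + s * β w by nlinarith)
        have h0 := survival_nonneg (ν := ν) (w + s * β w)
        gcongr
      -- Restart from `w + A * β w`, where the scale is at most `2 * β w`. Then `s / 4` new units
      -- are at most `s / 2` old ones, and `A + s / 2 ≤ s` because `2 * A < s`.
      · have hw' : w₀ < w + A * β w := by nlinarith
        have h4 := ih (w + A * β w) hw' h3 (s / 4) (by linarith) (by rw [pow_succ] at hs1; linarith)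
        obtain ⟨-, hb', -, -⟩ := hP _ hw' h3
        have h5 := survival_antitone (ν := ν) (show w + A * β w + s / 4 * β (w + A * β w) ≤
          w + s * β w by nlinarith)
        rw [div_lt_iff₀ hs] at h2
        have h6 : 0 ≤ s ^ 3 := by positivity
        have h7 : 0 ≤ (2 * A) ^ 3 := by positivity
        calc s ^ 3 * survival ν (w + s * β w)
            ≤ s ^ 3 * survival ν (w + A * β w + s / 4 * β (w + A * β w)) := by gcongr
          _ = 64 * ((s / 4) ^ 3 * survival ν (w + A * β w + s / 4 * β (w + A * β w))) := by ring
          _ ≤ 64 * ((2 * A) ^ 3 * survival ν (w + A * β w)) := by gcongr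
          _ ≤ 64 * ((2 * A) ^ 3 * (1 / 64 * survival ν w)) := by gcongr
          _ = _ := by ring
  refine ⟨8 * (1 + (2 * A) ^ 3), by positivity, eventually_toLeft_iff.2 ⟨w₀, hw₀, ?_⟩⟩
  intro w hw hs s hs0
  obtain ⟨n, hn⟩ := pow_unbounded_of_one_lt (s / (2 * A)) (show (1 : ℝ) < 4 by norm_num)
  rw [div_lt_iff₀ (by positivity)] at hn
  have h1 := key n w hw hs s hs0 (by linarith)
  obtain ⟨-, hb, -, -⟩ := hP w hw hs
  have h2 := survival_antitone (ν := ν) (show w ≤ w + s * β w by nlinarith)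
  have h3 := survival_nonneg (ν := ν) (w + s * β w)
  have h4 : (1 + s) ^ 3 ≤ 8 * (1 + s ^ 3) := by nlinarith [sq_nonneg (s - 1), mul_nonneg hs0 (sq_nonneg (s-1))]
  have h5 : (1 + s) ^ 3 * survival ν (w + s * β w) ≤ 8 * (1 + (2 * A) ^ 3) * survival ν w := by
    calc _ ≤ 8 * (1 + s ^ 3) * survival ν (w + s * β w) := by gcongr
      _ ≤ _ := by linarith
  have h6 : (1 + s) ^ (-3 : ℝ) = ((1 + s) ^ 3)⁻¹ := by
    rw [Real.rpow_neg (by positivity)]; norm_cast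
  rw [h6, mul_assoc, mul_comm _ (survival ν w), ← mul_assoc, ← div_eq_mul_inv, le_div_iff₀ (by positivity)]
  linarith

/-- Along moving arguments in a bounded range, `survival` decays exponentially. -/
theorem tendsto_moving (h : IsGammaTail ν β) {ι : Type*} {ℓ : Filter ι} {w r : ι → ℝ} {R : ℝ}
    (hw : Tendsto w ℓ (toLeft (rightEndpoint ν))) (hr : ∀ᶠ i in ℓ, r i ∈ Icc 0 R) :
    Tendsto (fun i => survival ν (w i + r i * β (w i)) / survival ν (w i) * Real.exp (r i)) ℓ
      (𝓝 1) := by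
  rw [tendsto_iff_ultrafilter]
  intro f hf
  obtain ⟨r₀, hr₀, hfr⟩ := (isCompact_Icc (a := (0 : ℝ)) (b := R)).ultrafilter_le_nhds (f.map r)
    (by rw [le_principal_iff]; exact hf hr)
  have hfr : Tendsto r f (𝓝 r₀) := hfr
  have hwf := hw.mono_left hf
  -- `β` is positive only near the end point; the absolute value makes the family antitone for every
  -- index.
  have h1 : Tendsto (fun i => survival ν (w i + (max (r i) 0) * |β (w i)|) / survival ν (w i)) f
      (𝓝 (Real.exp (-r₀))) := by
    refine tendsto_antitone_moving (a := 0) (g := fun t => Real.exp (-t))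
      (F := fun i t => survival ν (w i + t * |β (w i)|) / survival ν (w i))
      (y := fun i => max (r i) 0) ?_ (by fun_prop) ?_ ?_ hr₀.1 ?_
    · intro i s t hst
      have h0 := survival_nonneg (ν := ν) (w i)
      have := survival_antitone (ν := ν) (show w i + s * |β (w i)| ≤ w i + t * |β (w i)| by gcongr)
      simp only
      gcongr
    · intro t ht
      refine ((h.tendsto t ht).comp hwf).congr' ?_
      filter_upwards [hwf.eventually h.pos] with i hi
      simp [abs_of_pos hi]
    · have := hfr.max (tendsto_const_nhds (x := (0 : ℝ)))
      rwa [max_eq_left hr₀.1] at this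
    · exact Eventually.of_forall fun i => le_max_right _ _
  have h2 := h1.mul ((Real.continuous_exp.tendsto r₀).comp hfr)
  rw [← Real.exp_add, neg_add_cancel, Real.exp_zero] at h2
  refine h2.congr' ?_
  filter_upwards [hwf.eventually h.pos, hf hr] with i hi hi2
  simp [abs_of_pos hi, max_eq_left hi2.1]

/-- Survival may jump, so exact quantiles need not exist. Along the orbit of `w ↦ w + β w` near the
end point, each step multiplies survival by a factor between `exp (-2)` and `1 / 2`. It therefore
tends to zero without skipping a window of ratio `exp 2`. -/
theorem exists_survival_mem (h : IsGammaTail ν β) :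
    ∃ p₀, 0 < p₀ ∧ ∀ p, 0 < p → p < p₀ → ∃ w, p ≤ survival ν w ∧ survival ν w ≤ Real.exp 2 * p := by
  have he1 : Real.exp (-2) < Real.exp (-1) := Real.exp_lt_exp.2 (by norm_num)
  have he2 : Real.exp (-1) < 1 / 2 := by
    rw [Real.exp_neg, inv_lt_comm₀ (Real.exp_pos _) (by norm_num)]
    have := Real.exp_one_gt_d9
    norm_num
    linarith
  obtain ⟨w₀, hw₀, hP⟩ := eventually_toLeft_iff.1 (h.pos.and <|
    ((h.tendsto 1 zero_le_one).eventually_lt_const he2).and <|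
      (h.tendsto 1 zero_le_one).eventually_const_lt he1)
  obtain ⟨w₁, hw₁⟩ : ∃ w₁, w₀ < w₁ ∧ 0 < survival ν w₁ := by
    obtain ⟨y, h1, h2⟩ := EReal.lt_iff_exists_real_btwn.1 ((lt_rightEndpoint_iff w₀).2 hw₀)
    exact ⟨y, by exact_mod_cast h1, (lt_rightEndpoint_iff y).1 h2⟩
  let f : ℕ → ℝ := fun n => (fun w => w + 1 * β w)^[n] w₁
  have hf : ∀ n, f (n + 1) = f n + 1 * β (f n) := fun n => by
    simp only [f, Function.iterate_succ_apply']
  have hpos : ∀ n, w₀ < f n ∧ 0 < survival ν (f n) := by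
    intro n
    induction n with
    | zero => exact hw₁
    | succ n ih =>
      obtain ⟨h1, -, h3⟩ := hP _ ih.1 ih.2
      rw [hf]
      refine ⟨by linarith [ih.1], ?_⟩
      rw [lt_div_iff₀ ih.2] at h3
      exact (mul_pos (Real.exp_pos _) ih.2).trans h3
  have hsmall : ∀ n, survival ν (f n) ≤ (1 / 2) ^ n := by
    intro n
    induction n with
    | zero => simpa using survival_le_one _
    | succ n ih =>
      obtain ⟨-, h2, -⟩ := hP _ (hpos n).1 (hpos n).2
      rw [div_lt_iff₀ (hpos n).2] at h2
      rw [hf, pow_succ]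
      linarith
  refine ⟨survival ν w₁, hw₁.2, fun p hp hp1 => ?_⟩
  have hex : ∃ n, survival ν (f n) < p := by
    obtain ⟨n, hn⟩ := exists_pow_lt_of_lt_one hp (show (1 / 2 : ℝ) < 1 by norm_num)
    exact ⟨n, (hsmall n).trans_lt hn⟩
  classical
  obtain ⟨n, hn1, hn2⟩ : ∃ n, p ≤ survival ν (f n) ∧ survival ν (f (n + 1)) < p := by
    by_contra! hcon
    obtain ⟨n, hn⟩ := hex
    have : ∀ n, p ≤ survival ν (f n) := by
      intro n
      induction n with
      | zero => exact hp1.le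
      | succ n ih => exact hcon n ih
    exact absurd (this n) (not_le.2 hn)
  refine ⟨f n, hn1, ?_⟩
  obtain ⟨-, -, h3⟩ := hP _ (hpos n).1 (hpos n).2
  rw [lt_div_iff₀ (hpos n).2, ← hf] at h3
  have h4 : Real.exp 2 * Real.exp (-2) = 1 := by rw [← Real.exp_add]; simp
  nlinarith [Real.exp_pos 2, Real.exp_pos (-2)]

/-- Levels whose exceedance probabilities are asymptotic to a given null sequence. -/
theorem exists_levels (h : IsGammaTail ν β) {p : ℕ → ℝ} (hp0 : ∀ᶠ n in atTop, 0 < p n)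
    (hp : Tendsto p atTop (𝓝 0)) :
    ∃ v : ℕ → ℝ, Tendsto v atTop (toLeft (rightEndpoint ν)) ∧
      Tendsto (fun n => survival ν (v n) / p n) atTop (𝓝 1) := by
  obtain ⟨p₀, hp₀, H⟩ := h.exists_survival_mem
  have hev : ∀ᶠ n in atTop, ∃ w, p n ≤ survival ν w ∧ survival ν w ≤ Real.exp 2 * p n := by
    filter_upwards [hp0, hp.eventually_lt_const hp₀] with n h1 h2 using H _ h1 h2
  have : ∃ w : ℕ → ℝ, ∀ᶠ n in atTop, p n ≤ survival ν (w n) ∧ survival ν (w n) ≤ Real.exp 2 * p n := by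
    classical
    refine ⟨fun n => if hn : ∃ w, p n ≤ survival ν w ∧ survival ν w ≤ Real.exp 2 * p n then
      hn.choose else 0, ?_⟩
    filter_upwards [hev] with n hn
    rw [dif_pos hn]
    exact hn.choose_spec
  obtain ⟨w, hw⟩ := this
  have hwL : Tendsto w atTop (toLeft (rightEndpoint ν)) := by
    refine tendsto_toLeft_of_survival ?_ ?_
    · filter_upwards [hw, hp0] with n h1 h2 using h2.trans_le h1.1
    · refine tendsto_of_tendsto_of_tendsto_of_le_of_le' tendsto_const_nhds
        (by simpa using hp.const_mul (Real.exp 2)) ?_ (hw.mono fun n h => h.2)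
      exact Eventually.of_forall fun n => survival_nonneg _
  -- Moving up by `r` units of scale multiplies survival by about `exp (-r)`, which cancels the
  -- bounded error factor left by `exists_survival_mem`.
  let r : ℕ → ℝ := fun n => Real.log (survival ν (w n) / p n)
  have hr : ∀ᶠ n in atTop, r n ∈ Icc 0 2 := by
    filter_upwards [hw, hp0] with n h1 h2
    refine ⟨Real.log_nonneg ((one_le_div h2).2 h1.1), ?_⟩
    rw [Real.log_le_iff_le_exp (div_pos (h2.trans_le h1.1) h2), div_le_iff₀ h2]
    exact h1.2
  have hm := h.tendsto_moving hwL hr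
  have hlim : Tendsto (fun n => survival ν (w n + r n * β (w n)) / p n) atTop (𝓝 1) := by
    refine hm.congr' ?_
    filter_upwards [hw, hp0] with n h1 h2
    have h3 : 0 < survival ν (w n) := h2.trans_le h1.1
    simp only [r]
    rw [Real.exp_log (div_pos h3 h2)]
    field_simp
  refine ⟨fun n => w n + r n * β (w n), tendsto_toLeft_of_survival ?_ ?_, hlim⟩
  · filter_upwards [hlim.eventually_const_lt zero_lt_one, hp0] with n h1 h2
    by_contra! h3
    exact absurd h1 (not_lt.2 (div_nonpos_of_nonpos_of_nonneg h3 h2.le))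
  · have := hlim.mul hp
    rw [one_mul] at this
    refine this.congr' ?_
    filter_upwards [hp0] with n h1
    field_simp

end IsGammaTail

/-! ### The three conditions imply a tail of class `Γ` -/

section Conditions

variable {ν : Measure ℝ} [IsProbabilityMeasure ν]

theorem toLeft_neBot : (toLeft (rightEndpoint ν)).NeBot := by
  rw [neBot_iff]
  intro h
  have h1 : ∀ᶠ w in toLeft (rightEndpoint ν), False := by rw [h]; trivial
  obtain ⟨w₀, hw₀, hP⟩ := eventually_toLeft_iff.1 h1
  obtain ⟨y, h1, h2⟩ := EReal.lt_iff_exists_real_btwn.1 ((lt_rightEndpoint_iff w₀).2 hw₀)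
  exact hP y (EReal.coe_lt_coe_iff.1 h1) ((lt_rightEndpoint_iff y).1 h2)

theorem excessCDF_eq {u x : ℝ} (hu : 0 < survival ν u) (hx : 0 ≤ x) :
    excessCDF ν u x = 1 - survival ν (u + x) / survival ν u := by
  have hs : ν.real (Ioc u (u + x)) = survival ν u - survival ν (u + x) := by
    rw [survival, survival, ← measureReal_sdiff (Ioi_subset_Ioi (by linarith)) measurableSet_Ioi]
    congr 1
    ext y
    simp
  have h1 : {y : ℝ | u < y} ∩ {y | y - u ≤ x} = Ioc u (u + x) := by
    ext y
    simp [add_comm x u]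
  have hm : MeasurableSet {y : ℝ | u < y} := measurableSet_Ioi
  rw [excessCDF, measureReal_def, cond_apply hm, h1, ENNReal.toReal_mul, ENNReal.toReal_inv,
    ← measureReal_def, ← measureReal_def, hs, show {y : ℝ | u < y} = Ioi u from rfl,
    show ν.real (Ioi u) = survival ν u from rfl]
  field_simp

/-- The approximation at `x * β u` is the Γ relation, once `u + x * β u` is known not to exceed the
end point. If it did, evaluating at the end point, where survival is zero, would give an error above
`exp (-x)`. The second term of the `min` below forbids this. -/
theorem HasGPDZeroApproximation.isGammaTail (h : HasGPDZeroApproximation ν) :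
    ∃ β, IsGammaTail ν β := by
  obtain ⟨β, -, hpos, happ⟩ := h
  have hβ : ∀ᶠ w in toLeft (rightEndpoint ν), 0 < β w :=
    eventually_survival_pos.mono fun w hw => hpos w ((lt_rightEndpoint_iff w).2 hw)
  refine ⟨β, hβ, fun x hx => ?_⟩
  rw [Metric.tendsto_nhds]
  intro ε hε
  have he := Real.exp_pos (-x)
  filter_upwards [happ (min (ε / 2) (Real.exp (-x) / 2)) (by positivity), hβ,
    eventually_survival_pos] with u hu hb hs
  have hle : ((u + x * β u : ℝ) : EReal) ≤ rightEndpoint ν := by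
    by_contra! hlt
    have hu' := (lt_rightEndpoint_iff u).2 hs
    obtain ⟨e, hE⟩ : ∃ e : ℝ, rightEndpoint ν = e := by
      refine ⟨(rightEndpoint ν).toReal, (EReal.coe_toReal ?_ ?_).symm⟩
      · exact (hlt.trans (EReal.coe_lt_top _)).ne
      · exact ((EReal.bot_lt_coe u).trans hu').ne'
    rw [hE, EReal.coe_lt_coe_iff] at hlt hu'
    have h1 := hu (e - u) (by linarith) (by rw [hE]; simp)
    have h2 : survival ν e = 0 := by
      refine le_antisymm ?_ (survival_nonneg _)
      by_contra! h
      have := (lt_rightEndpoint_iff e).2 h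
      rw [hE] at this
      exact lt_irrefl _ this
    rw [excessCDF_eq hs (by linarith), gpdZero, add_sub_cancel, h2, zero_div] at h1
    have h3 : -x < -(e - u) / β u := by
      rw [lt_div_iff₀ hb]; linarith
    have h4 := Real.exp_lt_exp.2 h3
    have h5 := (le_abs_self _).trans (h1.trans (min_le_right _ _))
    linarith
  have h1 := (hu (x * β u) (by positivity) hle).trans (min_le_left _ _)
  rw [excessCDF_eq hs (by positivity), gpdZero, neg_div, mul_div_assoc, div_self hb.ne',
    mul_one] at h1
  rw [Real.dist_eq, abs_sub_comm]
  calc _ = |1 - survival ν (u + x * β u) / survival ν u - (1 - Real.exp (-x))| := by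
        congr 1; ring
    _ ≤ ε / 2 := h1
    _ < ε := by linarith

/-- If `q n ^ n → exp (-τ)` with `q n ∈ [0, 1]`, then `n (1 - q n) → τ`. -/
theorem tendsto_mul_one_sub_of_pow {q : ℕ → ℝ} {τ : ℝ} (h0 : ∀ n, 0 ≤ q n)
    (h : Tendsto (fun n => q n ^ n) atTop (𝓝 (Real.exp (-τ)))) :
    Tendsto (fun n : ℕ => n * (1 - q n)) atTop (𝓝 τ) := by
  have hq : ∀ᶠ n in atTop, 0 < q n := by
    filter_upwards [h.eventually_const_lt (Real.exp_pos _), eventually_ge_atTop 1] with n h1 h2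
    refine (h0 n).lt_of_ne fun h3 => ?_
    rw [← h3, zero_pow (by omega)] at h1
    exact lt_irrefl _ h1
  have hlog : Tendsto (fun n : ℕ => n * (-Real.log (q n))) atTop (𝓝 τ) := by
    have := (h.log (Real.exp_pos _).ne').neg
    simp only [Real.log_exp, neg_neg, Real.log_pow] at this
    exact this.congr fun n => by ring
  have hlog0 : Tendsto (fun n => Real.log (q n)) atTop (𝓝 0) := by
    have := (hlog.mul (tendsto_inv_atTop_nhds_zero_nat (𝕜 := ℝ))).neg
    rw [mul_zero, neg_zero] at this
    refine this.congr' ?_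
    filter_upwards [eventually_ge_atTop 1] with n hn
    have : (n : ℝ) ≠ 0 := by positivity
    field_simp
  have hq1 : Tendsto q atTop (𝓝 1) := by
    have := (Real.continuous_exp.tendsto 0).comp hlog0
    rw [Real.exp_zero] at this
    refine this.congr' ?_
    filter_upwards [hq] with n hn using Real.exp_log hn
  -- Squeeze by `q * (-log q) ≤ 1 - q ≤ -log q`, where `q → 1`.
  have hlow := hq1.mul hlog
  rw [one_mul] at hlow
  refine tendsto_of_tendsto_of_tendsto_of_le_of_le' hlow hlog ?_ ?_
  · filter_upwards [hq] with n hn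
    have h1 := Real.one_sub_inv_le_log_of_pos hn
    have h2 : q n * (1 - (q n)⁻¹) = q n - 1 := by field_simp
    have h3 := mul_le_mul_of_nonneg_left h1 hn.le
    have h4 : (0 : ℝ) ≤ n := Nat.cast_nonneg n
    nlinarith
  · filter_upwards [hq] with n hn
    have h1 := Real.log_le_sub_one_of_pos hn
    have h4 : (0 : ℝ) ≤ n := Nat.cast_nonneg n
    nlinarith

/-- Taking logarithms, `n` times survival at `c n * x + d n` tends to `exp (-x)`. With `m w` the
integer part of the reciprocal of survival at `w`, inversion gives `w = c m * y + d m` with `y → 0`.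
Hence `c (m w)` serves as auxiliary function. -/
theorem InGumbelMaxDomain.isGammaTail (h : InGumbelMaxDomain ν) : ∃ β, IsGammaTail ν β := by
  obtain ⟨c, d, hc, hlim⟩ := h
  have hG : ∀ x, Tendsto (fun n : ℕ => n * survival ν (c n * x + d n)) atTop
      (𝓝 (Real.exp (-x))) := by
    intro x
    refine (tendsto_mul_one_sub_of_pow (fun n => cdf_nonneg ν _) (hlim x)).congr fun n => ?_
    rw [one_sub_cdf]
  -- The levels `d n` have survival about `1 / n`, eventually positive, so survival takes
  -- arbitrarily small positive values.
  have hG0 : Tendsto (survival ν) (toLeft (rightEndpoint ν)) (𝓝 0) := by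
    have h1 := (hG 0).mul (tendsto_inv_atTop_nhds_zero_nat (𝕜 := ℝ))
    rw [mul_zero] at h1
    rw [tendsto_order]
    refine ⟨fun e he => Eventually.of_forall fun w => he.trans_le (survival_nonneg w),
      fun e he => ?_⟩
    obtain ⟨n, h2, h3, h4⟩ := ((h1.eventually_lt_const he).and
      (((hG 0).eventually_const_lt (Real.exp_pos _)).and (eventually_ge_atTop 1))).exists
    have hn : (0 : ℝ) < n := by positivity
    filter_upwards [eventually_gt_toLeft (pos_of_mul_pos_right h3 hn.le)] with w hw
    refine (survival_antitone (ν := ν) hw.le).trans_lt ?_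
    field_simp at h2
    simpa using h2
  let m : ℝ → ℕ := fun w => ⌊(survival ν w)⁻¹⌋₊
  have hinv : Tendsto (fun w => (survival ν w)⁻¹) (toLeft (rightEndpoint ν)) atTop :=
    tendsto_inv_nhdsGT_zero.comp (tendsto_nhdsWithin_iff.2 ⟨hG0, eventually_survival_pos⟩)
  have hm : Tendsto m (toLeft (rightEndpoint ν)) atTop := tendsto_nat_floor_atTop.comp hinv
  have hθ : Tendsto (fun w => m w * survival ν w) (toLeft (rightEndpoint ν)) (𝓝 1) := by
    refine (tendsto_nat_floor_div_atTop.comp hinv).congr fun w => ?_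
    simp [m]
  have hF : ∀ x, Tendsto (fun w => m w * survival ν (c (m w) * x + d (m w)))
      (toLeft (rightEndpoint ν)) (𝓝 (Real.exp (-x))) := fun x => (hG x).comp hm
  have hy : Tendsto (fun w => (w - d (m w)) / c (m w)) (toLeft (rightEndpoint ν)) (𝓝 0) := by
    refine tendsto_of_quantile (a := -1) (θ := fun w => m w * survival ν w) (fun t _ => hF t)
      (by simpa using hθ) (by norm_num) (Eventually.of_forall fun w t ht => ?_)
      (Eventually.of_forall fun w t ht => ?_)
    · rw [lt_div_iff₀ (hc _)] at ht
      gcongr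
      exact survival_antitone (by linarith)
    · rw [div_le_iff₀ (hc _)] at ht
      gcongr
      exact survival_antitone (by linarith)
  refine ⟨fun w => c (m w), Eventually.of_forall fun w => hc _, fun x hx => ?_⟩
  have hx' : Tendsto (fun w => (w - d (m w)) / c (m w) + x) (toLeft (rightEndpoint ν)) (𝓝 x) := by
    simpa using hy.add_const x
  have h1 := tendsto_antitone_moving (a := x - 1) (g := fun t => Real.exp (-t))
    (F := fun w t => m w * survival ν (c (m w) * t + d (m w))) (y₀ := x)
    (fun w s t hst => by
      have := survival_antitone (ν := ν) (show c (m w) * s + d (m w) ≤ c (m w) * t + d (m w) by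
        have := (hc (m w)).le
        gcongr)
      simp only
      gcongr) (by fun_prop) (fun t _ => hF t) hx' (by linarith)
    (hx'.eventually_const_le (by linarith))
  have h2 := h1.div hθ one_ne_zero
  rw [div_one] at h2
  refine h2.congr' ?_
  filter_upwards [hθ.eventually_const_lt zero_lt_one, eventually_survival_pos] with w h3 h4
  have h5 : (m w : ℝ) ≠ 0 := fun h => by simp [h] at h3
  have h6 := (hc (m w)).ne'
  simp only [Pi.div_apply]
  rw [mul_div_mul_left _ _ h5]
  congr 2
  field_simp
  ring

theorem tendsto_toLeft_of_le {f : ℝ → ℝ}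
    (h : ∀ᶠ w in toLeft (rightEndpoint ν), w ≤ f w ∧ 0 < survival ν (f w)) :
    Tendsto f (toLeft (rightEndpoint ν)) (toLeft (rightEndpoint ν)) := by
  intro s hs
  obtain ⟨w₀, hw₀, hP⟩ := eventually_toLeft_iff.1 hs
  rw [mem_map]
  filter_upwards [h, eventually_gt_toLeft hw₀] with w h1 h2
  exact hP _ (h2.trans_le h1.1) h1.2

/-- As `a' → 0`, `a` is nearly constant on `[w, w + x * a w]`. The integral of `1 / a` over it is
thus nearly `x`, the ratio of the values of `c` tends to one, and `a` itself is an auxiliary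
function. -/
theorem HasVonMisesRepresentation.isGammaTail (h : HasVonMisesRepresentation ν) :
    ∃ β, IsGammaTail ν β := by
  obtain ⟨z, c, a, a', c₀, hz, -, hc₀, hc, ha, hint, ha', hrep, hF⟩ := h
  simp only [lt_rightEndpoint_iff, one_sub_cdf] at hz ha hint hrep
  have hG0 : Tendsto (survival ν) (toLeft (rightEndpoint ν)) (𝓝 0) := by
    have := hF.const_sub 1
    simpa [one_sub_cdf] using this
  have hrate : ∀ x, 0 ≤ x → ∀ ε, 0 < ε → ε * x ≤ 1 / 2 → ∀ᶠ w in toLeft (rightEndpoint ν),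
      ∀ t, w ≤ t → t ≤ w + x * a w → 0 < survival ν t →
        |(∫ s in w..t, 1 / a s) - (t - w) / a w| ≤ 2 * ε * x ^ 2 := by
    intro x hx ε hε hεx
    obtain ⟨w₀, hw₀, hP⟩ := eventually_toLeft_iff.1 ((Metric.tendsto_nhds.1 ha') ε hε)
    filter_upwards [eventually_gt_toLeft hw₀, eventually_gt_toLeft hz,
      eventually_survival_pos] with w h1 h2 h3 t hwt htx ht
    have haw := ha w h2 h3
    have hsur : ∀ s, s ≤ t → 0 < survival ν s := fun s hs => ht.trans_le (survival_antitone hs)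
    have hpt : ∀ s, w ≤ s → s ≤ t → ‖1 / a s - 1 / a w‖ ≤ 2 * ε * x / a w := by
      intro s hws hst
      have has := ha s (h2.trans_le hws) (hsur s hst)
      have h4 : |a s - a w| ≤ ε * (s - w) := by
        rw [(hint w s h2 hws (hsur s hst)).2]
        have := intervalIntegral.norm_integral_le_of_norm_le_const (a := w) (b := s) (C := ε)
          (f := a') (fun r hr => by
            rw [uIoc_of_le hws] at hr
            have := hP r (h1.trans hr.1) (hsur r (hr.2.trans hst))
            rw [dist_zero_right] at this
            exact this.le)
        rwa [abs_of_nonneg (sub_nonneg.2 hws)] at this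
      have h5 : ε * (s - w) ≤ ε * x * a w := by
        rw [mul_assoc]
        gcongr
        linarith
      -- This is where `ε * x ≤ 1 / 2` enters: it keeps `1 / a s` under control.
      have h6 : a w / 2 ≤ a s := by
        have := (abs_le.1 (h4.trans h5)).1
        nlinarith
      rw [Real.norm_eq_abs, div_sub_div _ _ has.ne' haw.ne', abs_div, abs_of_pos (mul_pos has haw),
        div_le_div_iff₀ (mul_pos has haw) haw, one_mul, mul_one, abs_sub_comm]
      calc |a s - a w| * a w ≤ (ε * x * a w) * a w := by
            gcongr
            exact h4.trans h5
        _ = 2 * ε * x * (a w / 2 * a w) := by ring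
        _ ≤ 2 * ε * x * (a s * a w) := by gcongr
    have hi : IntervalIntegrable (fun s => 1 / a s) volume w t :=
      (hrep w h2 h3).1.symm.trans (hrep t (h2.trans_le hwt) ht).1
    have h7 := intervalIntegral.norm_integral_le_of_norm_le_const (a := w) (b := t)
      (C := 2 * ε * x / a w) (f := fun s => 1 / a s - 1 / a w) (fun s hs => by
        rw [uIoc_of_le hwt] at hs
        exact hpt s hs.1.le hs.2)
    rw [intervalIntegral.integral_sub hi intervalIntegrable_const, intervalIntegral.integral_const,
      abs_of_nonneg (sub_nonneg.2 hwt), smul_eq_mul, mul_one_div, Real.norm_eq_abs] at h7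
    refine h7.trans ?_
    calc 2 * ε * x / a w * (t - w) ≤ 2 * ε * x / a w * (x * a w) := by
          gcongr
          linarith
      _ = 2 * ε * x ^ 2 := by field_simp
  have hadd : ∀ w t, z < w → w ≤ t → 0 < survival ν t →
      (∫ s in z..t, 1 / a s) = (∫ s in z..w, 1 / a s) + ∫ s in w..t, 1 / a s := by
    intro w t h1 h2 h3
    have h4 := (hrep w h1 (h3.trans_le (survival_antitone h2))).1
    exact (intervalIntegral.integral_add_adjacent_intervals h4
      (h4.symm.trans (hrep t (h1.trans_le h2) h3).1)).symm
  have hshift : ∀ x, 0 ≤ x → ∀ᶠ w in toLeft (rightEndpoint ν),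
      w ≤ w + x * a w ∧ 0 < survival ν (w + x * a w) := by
    intro x hx
    -- With this `ε` the error `2 * ε * x ^ 2` is at most `x`. If the shift reached the end point,
    -- the integral from `w` would stay below `2 * x` all the way there, and survival would stay
    -- bounded away from zero.
    have hε : 1 / (2 * (x + 1)) * x ≤ 1 / 2 := by
      rw [div_mul_eq_mul_div, div_le_div_iff₀ (by positivity) (by norm_num)]
      linarith
    filter_upwards [hrate x hx (1 / (2 * (x + 1))) (by positivity) hε, eventually_gt_toLeft hz,
      eventually_survival_pos] with w h1 h2 h3
    have haw := ha w h2 h3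
    refine ⟨by nlinarith, ?_⟩
    by_contra! hle
    set I := ∫ s in z..w, 1 / a s
    have hlow : ∀ᶠ t in toLeft (rightEndpoint ν),
        c t * Real.exp (-(I + (x + x))) ≤ survival ν t := by
      filter_upwards [eventually_gt_toLeft h3, eventually_survival_pos,
        hc.eventually_const_lt hc₀] with t h4 h5 h6
      have h7 : t ≤ w + x * a w := by
        by_contra! h8
        exact absurd h5 (not_lt.2 ((survival_antitone h8.le).trans hle))
      have h8 := (abs_le.1 (h1 t h4.le h7 h5)).2
      have h9 : (t - w) / a w ≤ x := by rw [div_le_iff₀ haw]; linarith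
      have h10 : 2 * (1 / (2 * (x + 1))) * x ^ 2 ≤ x := by nlinarith
      rw [(hrep t (h2.trans h4) h5).2, hadd w t h2 h4.le h5]
      gcongr
      linarith
    have := toLeft_neBot (ν := ν)
    have h4 := le_of_tendsto_of_tendsto (hc.mul_const _) hG0 hlow
    exact absurd h4 (not_le.2 (by positivity))
  refine ⟨a, ?_, fun x hx => ?_⟩
  · filter_upwards [eventually_gt_toLeft hz, eventually_survival_pos] with w h1 h2 using ha w h1 h2
  have hI : Tendsto (fun w => ∫ s in w..(w + x * a w), 1 / a s) (toLeft (rightEndpoint ν))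
      (𝓝 x) := by
    rw [Metric.tendsto_nhds]
    intro δ hδ
    have hK : 0 < 2 * (x ^ 2 + x + 1) := by positivity
    obtain ⟨ε, hε, hε1, hε2⟩ : ∃ ε, 0 < ε ∧ ε * x ≤ 1 / 2 ∧ 2 * ε * x ^ 2 < δ := by
      refine ⟨min 1 (δ / 2) / (2 * (x ^ 2 + x + 1)), by positivity, ?_, ?_⟩
      · rw [div_mul_eq_mul_div, div_le_div_iff₀ hK (by norm_num)]
        have : min 1 (δ / 2) ≤ 1 := min_le_left _ _
        nlinarith [sq_nonneg x]
      · rw [mul_div_assoc', div_mul_eq_mul_div, div_lt_iff₀ hK]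
        have : min 1 (δ / 2) ≤ δ / 2 := min_le_right _ _
        nlinarith [sq_nonneg x]
    filter_upwards [hrate x hx ε hε hε1, hshift x hx, eventually_gt_toLeft hz,
      eventually_survival_pos] with w h1 h2 h3 h4
    have := h1 _ h2.1 le_rfl h2.2
    rw [add_sub_cancel_left, mul_div_cancel_right₀ _ (ha w h3 h4).ne'] at this
    exact this.trans_lt hε2
  have hc' := (hc.comp (tendsto_toLeft_of_le (hshift x hx))).div hc hc₀.ne'
  rw [div_self hc₀.ne'] at hc'
  have h1 := hc'.mul ((Real.continuous_exp.tendsto _).comp hI.neg)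
  rw [one_mul] at h1
  refine h1.congr' ?_
  filter_upwards [hshift x hx, eventually_gt_toLeft hz, eventually_survival_pos] with w h2 h3 h4
  rw [(hrep _ (h3.trans_le h2.1) h2.2).2, (hrep _ h3 h4).2, hadd w _ h3 h2.1 h2.2, neg_add,
    Real.exp_add]
  have := Real.exp_pos (-∫ s in z..w, 1 / a s)
  simp only [Function.comp_apply, Pi.div_apply]
  field_simp

end Conditions

/-! ### Order statistics and exceedances -/

/-- The number of `j < n` with `x j > v`. -/
def exceedances (n : ℕ) (x : ℕ → ℝ) (v : ℝ) : ℝ :=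
  ∑ j ∈ Finset.range n, if v < x j then (1 : ℝ) else 0

/-- The sum of the excesses over `v` of `x 0, …, x (n - 1)`. -/
def totalExcess (n : ℕ) (x : ℕ → ℝ) (v : ℝ) : ℝ :=
  ∑ j ∈ Finset.range n, if v < x j then x j - v else 0

theorem empiricalME_eq (n : ℕ) (x : ℕ → ℝ) (v : ℝ) :
    empiricalME n x v = totalExcess n x v / exceedances n x v := rfl

theorem exceedances_antitone (n : ℕ) (x : ℕ → ℝ) : Antitone (exceedances n x) := by
  intro v w hvw
  refine Finset.sum_le_sum fun j _ => ?_
  split_ifs with h1 h2 <;> first | exact le_rfl | exact zero_le_one | linarith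

theorem totalExcess_antitone (n : ℕ) (x : ℕ → ℝ) : Antitone (totalExcess n x) := by
  intro v w hvw
  refine Finset.sum_le_sum fun j _ => ?_
  split_ifs with h1 h2 <;> linarith

/-- In the increasing sort, `x_(i)` has zero-based position `n - i`, with `i` positions from there
on and `i - 1` strictly after. This duality turns order statistics into counts, ties included. -/
theorem lt_orderStat_iff {n i : ℕ} {x : ℕ → ℝ} (h1 : 1 ≤ i) (h2 : i ≤ n) (v : ℝ) :
    v < orderStat n x i ↔ (i : ℝ) ≤ exceedances n x v := by
  have hcount : exceedances n x v = ((Finset.univ.filter fun j : Fin n =>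
      v < x (Tuple.sort (fun j : Fin n => x j) j)).card : ℝ) := by
    rw [exceedances, ← Fin.sum_univ_eq_sum_range (fun j => if v < x j then (1 : ℝ) else 0) n,
      ← Equiv.sum_comp (Tuple.sort fun j : Fin n => x j), Finset.sum_boole]
  have hmono := Tuple.monotone_sort (fun j : Fin n => x j)
  rw [hcount, Nat.cast_le, orderStat, dif_pos ⟨h1, h2⟩]
  constructor
  · intro h
    have hsub : Finset.Ici (⟨n - i, by omega⟩ : Fin n) ⊆ Finset.univ.filter fun j : Fin n =>
        v < x (Tuple.sort (fun j : Fin n => x j) j) := by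
      intro j hj
      rw [Finset.mem_filter]
      exact ⟨Finset.mem_univ _, h.trans_le (hmono (Finset.mem_Ici.1 hj))⟩
    have := Finset.card_le_card hsub
    rw [Fin.card_Ici] at this
    simp only at this
    omega
  · intro h
    by_contra! hv
    have hsub : (Finset.univ.filter fun j : Fin n =>
        v < x (Tuple.sort (fun j : Fin n => x j) j)) ⊆ Finset.Ioi (⟨n - i, by omega⟩ : Fin n) := by
      intro j hj
      rw [Finset.mem_filter] at hj
      rw [Finset.mem_Ioi]
      by_contra! hle
      exact absurd (hj.2.trans_le (hmono hle)) (not_lt.2 hv)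
    have := Finset.card_le_card hsub
    rw [Fin.card_Ioi] at this
    simp only at this
    omega

theorem orderStat_le_orderStat {n i j : ℕ} {x : ℕ → ℝ} (h1 : 1 ≤ i) (hij : i ≤ j) (hj : j ≤ n) :
    orderStat n x j ≤ orderStat n x i := by
  by_contra! h
  have h2 := (lt_orderStat_iff (h1.trans hij) hj _).1 h
  have h3 : (i : ℝ) ≤ j := by exact_mod_cast hij
  exact lt_irrefl _ ((lt_orderStat_iff h1 (hij.trans hj) _).2 (h3.trans h2))

/-- This replaces the passage to a subsequence: along an ultrafilter, quantities in a compact set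
converge. -/
theorem exists_ultrafilter_of_frequently {ι : Type*} {ℓ : Filter ι} {P : ι → Prop}
    (h : ∃ᶠ j in ℓ, P j) : ∃ f : Ultrafilter ι, ↑f ≤ ℓ ∧ ∀ᶠ j in (f : Filter ι), P j := by
  have hne : (ℓ ⊓ 𝓟 {j | P j}).NeBot := frequently_mem_iff_neBot.1 h
  have hf := Ultrafilter.of_le (ℓ ⊓ 𝓟 {j | P j})
  exact ⟨Ultrafilter.of (ℓ ⊓ 𝓟 {j | P j}), hf.trans inf_le_left,
    le_principal_iff.1 (hf.trans inf_le_right)⟩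

/-! ### Convergence of mean excess plots along a filter -/

/-- Numbers of exceedances and total excesses over the levels `u + y b` behave asymptotically as in
a sample whose excesses are exponential with mean `b`, the level `u` being exceeded `k` times. -/
structure ExponentialExcesses {ι : Type*} (ℓ : Filter ι) (n k : ι → ℕ) (x : ι → ℕ → ℝ)
    (u b : ι → ℝ) : Prop where
  pos : ∀ i, 0 < b i
  le : ∀ᶠ i in ℓ, k i ≤ n i
  tendsto_k : Tendsto k ℓ atTop
  count : ∀ y, -1 ≤ y → Tendsto (fun i => exceedances (n i) (x i) (u i + y * b i) / k i) ℓ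
    (𝓝 (Real.exp (-y)))
  total : ∀ y, -1 ≤ y → Tendsto (fun i => totalExcess (n i) (x i) (u i + y * b i) / (k i * b i)) ℓ
    (𝓝 (Real.exp (-y)))

namespace ExponentialExcesses

variable {ι : Type*} {ℓ : Filter ι} {n k : ι → ℕ} {x : ι → ℕ → ℝ} {u b : ι → ℝ}

theorem mono {ℓ' : Filter ι} (h : ExponentialExcesses ℓ n k x u b) (hle : ℓ' ≤ ℓ) :
    ExponentialExcesses ℓ' n k x u b :=
  ⟨h.pos, h.le.filter_mono hle, h.tendsto_k.mono_left hle, fun y hy => (h.count y hy).mono_left hle,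
    fun y hy => (h.total y hy).mono_left hle⟩

/-- By `lt_orderStat_iff`, the normalised order statistic is a generalized inverse of the count
function at height `i / k`, and the limit `exp (-y)` is strictly decreasing. -/
theorem tendsto_orderStat (h : ExponentialExcesses ℓ n k x u b) {i : ι → ℕ} {y₀ : ℝ}
    (hy₀ : -1 < y₀) (hi : ∀ᶠ j in ℓ, 1 ≤ i j ∧ i j ≤ k j)
    (hik : Tendsto (fun j => (i j : ℝ) / k j) ℓ (𝓝 (Real.exp (-y₀)))) :
    Tendsto (fun j => (orderStat (n j) (x j) (i j) - u j) / b j) ℓ (𝓝 y₀) := by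
  refine tendsto_of_quantile h.count hik hy₀ ?_ ?_
  · filter_upwards [hi, h.le] with j h1 h2 t ht
    rw [lt_div_iff₀ (h.pos j)] at ht
    gcongr
    rw [← lt_orderStat_iff h1.1 (h1.2.trans h2)]
    linarith
  · filter_upwards [hi, h.le] with j h1 h2 t ht
    rw [div_le_iff₀ (h.pos j)] at ht
    gcongr
    refine le_of_not_ge fun h3 => ?_
    rw [← lt_orderStat_iff h1.1 (h1.2.trans h2)] at h3
    linarith

/-- Totals and counts have the same limit `exp (-y₀)` after normalisation, which cancels.
Monotonicity in the level admits random `v`. -/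
theorem tendsto_empiricalME (h : ExponentialExcesses ℓ n k x u b) {v : ι → ℝ} {y₀ : ℝ}
    (hy₀ : -1 < y₀) (hv : Tendsto (fun j => (v j - u j) / b j) ℓ (𝓝 y₀)) :
    Tendsto (fun j => empiricalME (n j) (x j) (v j) / b j) ℓ (𝓝 1) := by
  have h1 := tendsto_antitone_moving (g := fun t => Real.exp (-t))
    (F := fun j t => totalExcess (n j) (x j) (u j + t * b j) / (k j * b j))
    (fun j s t hst => by
      have hb := (h.pos j).le
      have := totalExcess_antitone (n j) (x j) (show u j + s * b j ≤ u j + t * b j by gcongr)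
      simp only
      gcongr) (by fun_prop) h.total hv hy₀.le (hv.eventually_const_le hy₀)
  have h2 := tendsto_antitone_moving (g := fun t => Real.exp (-t))
    (F := fun j t => exceedances (n j) (x j) (u j + t * b j) / k j)
    (fun j s t hst => by
      have hb := (h.pos j).le
      have := exceedances_antitone (n j) (x j) (show u j + s * b j ≤ u j + t * b j by gcongr)
      simp only
      gcongr) (by fun_prop) h.count hv hy₀.le (hv.eventually_const_le hy₀)
  have h3 := h1.div h2 (Real.exp_pos _).ne'
  rw [div_self (Real.exp_pos _).ne'] at h3
  refine h3.congr' ?_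
  filter_upwards [h.tendsto_k.eventually_ge_atTop 1] with j hj
  have hb := (h.pos j).ne'
  have hk : (k j : ℝ) ≠ 0 := by positivity
  have e : u j + (v j - u j) / b j * b j = v j := by field_simp; ring
  simp only [Pi.div_apply, e]
  rw [empiricalME_eq, div_div_div_eq, mul_comm (k j : ℝ) (b j), mul_assoc, mul_comm (b j),
    mul_comm (totalExcess _ _ _), mul_assoc, mul_div_mul_left _ _ hk, div_div]

theorem tendsto_orderStat_self (h : ExponentialExcesses ℓ n k x u b) :
    Tendsto (fun j => (orderStat (n j) (x j) (k j) - u j) / b j) ℓ (𝓝 0) := by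
  refine h.tendsto_orderStat (by norm_num) ?_ ?_
  · filter_upwards [h.tendsto_k.eventually_ge_atTop 1] with j hj using ⟨hj, le_rfl⟩
  · rw [neg_zero, Real.exp_zero]
    refine tendsto_const_nhds.congr' ?_
    filter_upwards [h.tendsto_k.eventually_ge_atTop 1] with j hj
    rw [div_self (by positivity)]

theorem tendsto_orderStat_ceil (h : ExponentialExcesses ℓ n k x u b) {y : ℝ} (hy : 0 ≤ y) :
    Tendsto (fun j => (orderStat (n j) (x j) ⌈Real.exp (-y) * k j⌉₊ - u j) / b j) ℓ (𝓝 y) := by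
  refine h.tendsto_orderStat (by linarith) ?_ ?_
  · filter_upwards [h.tendsto_k.eventually_ge_atTop 1] with j hj
    refine ⟨Nat.one_le_ceil_iff.2 (by positivity), Nat.ceil_le.2 ?_⟩
    exact mul_le_of_le_one_left (Nat.cast_nonneg _) (Real.exp_le_one_iff.2 (by linarith))
  · exact (tendsto_nat_ceil_mul_div_atTop (Real.exp_pos _).le).comp
      (tendsto_natCast_atTop_atTop.comp h.tendsto_k)

theorem tendsto_scale (h : ExponentialExcesses ℓ n k x u b) :
    Tendsto (fun j => (orderStat (n j) (x j) ⌈(k j : ℝ) / 2⌉₊ - orderStat (n j) (x j) (k j)) / b j)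
      ℓ (𝓝 (Real.log 2)) := by
  have h1 := (h.tendsto_orderStat_ceil (Real.log_nonneg one_le_two)).sub h.tendsto_orderStat_self
  rw [sub_zero, Real.exp_neg, Real.exp_log two_pos] at h1
  refine h1.congr fun j => ?_
  rw [← sub_div, sub_sub_sub_cancel_right, inv_mul_eq_div]

theorem tendsto_point (h : ExponentialExcesses ℓ n k x u b) {v : ι → ℝ} {y₀ : ℝ}
    (hy₀ : -1 < y₀) (hv : Tendsto (fun j => (v j - u j) / b j) ℓ (𝓝 y₀)) :
    Tendsto (fun j => (orderStat (n j) (x j) ⌈(k j : ℝ) / 2⌉₊ - orderStat (n j) (x j) (k j))⁻¹ •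
      ((v j - orderStat (n j) (x j) (k j), empiricalME (n j) (x j) (v j)) : ℝ × ℝ)) ℓ
      (𝓝 (y₀ / Real.log 2, 1 / Real.log 2)) := by
  have hl := (Real.log_pos one_lt_two).ne'
  have h1 := (hv.sub h.tendsto_orderStat_self).div h.tendsto_scale hl
  rw [sub_zero] at h1
  have h2 := (h.tendsto_empiricalME hy₀ hv).div h.tendsto_scale hl
  refine (h1.prodMk_nhds h2).congr fun j => ?_
  have hb := (h.pos j).ne'
  ext
  · simp only [Pi.div_apply, Prod.smul_mk, smul_eq_mul]
    rw [← sub_div, sub_sub_sub_cancel_right, div_div_div_cancel_right₀ hb, inv_mul_eq_div]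
  · simp only [Pi.div_apply, Prod.smul_mk, smul_eq_mul]
    rw [div_div_div_cancel_right₀ hb, inv_mul_eq_div]

/-- If the plots met `K` frequently, some choice of points in `K` would have abscissas that are
nonnegative (as `i ≤ k`) and bounded. Along an ultrafilter they converge, the points tend to a point
of the half-line, and that point lies in the closed set `K`. -/
theorem eventually_miss (h : ExponentialExcesses ℓ n k x u b) {K : Set (ℝ × ℝ)} (hK : IsCompact K)
    (hmiss : (horizontalHalfLine (1 / Real.log 2) : Set (ℝ × ℝ)) ∩ K = ∅) :
    ∀ᶠ j in ℓ, (mePlot (n j) (k j) (x j) : Set (ℝ × ℝ)) ∩ K = ∅ := by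
  by_contra hcon
  have hex : ∃ᶠ j in ℓ, ∃ i : ℕ, (1 < i ∧ i ≤ k j) ∧
      (orderStat (n j) (x j) ⌈(k j : ℝ) / 2⌉₊ - orderStat (n j) (x j) (k j))⁻¹ •
        ((orderStat (n j) (x j) i - orderStat (n j) (x j) (k j),
          empiricalME (n j) (x j) (orderStat (n j) (x j) i)) : ℝ × ℝ) ∈ K := by
    refine (not_eventually.1 hcon).mono fun j hj => ?_
    obtain ⟨p, ⟨i, hi, rfl⟩, hpK⟩ := nonempty_iff_ne_empty.2 hj
    exact ⟨i, hi, hpK⟩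
  obtain ⟨f, hfl, hf'⟩ := exists_ultrafilter_of_frequently hex
  obtain ⟨i, hi⟩ := hf'.choice
  replace h := h.mono hfl
  obtain ⟨R, hR⟩ := hK.isBounded.subset_closedBall 0
  let s : ι → ℝ := fun j => (orderStat (n j) (x j) ⌈(k j : ℝ) / 2⌉₊ - orderStat (n j) (x j) (k j))⁻¹ *
    (orderStat (n j) (x j) (i j) - orderStat (n j) (x j) (k j))
  have hl := Real.log_pos one_lt_two
  have hs : ∀ᶠ j in (f : Filter ι), s j ∈ Icc 0 R := by
    filter_upwards [hi, h.le, h.tendsto_scale.eventually_const_lt hl] with j h1 h2 h3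
    constructor
    · have h4 := orderStat_le_orderStat (x := x j) h1.1.1.le h1.1.2 h2
      have h5 := pos_of_mul_pos_left (by rwa [div_eq_mul_inv] at h3) (inv_nonneg.2 (h.pos j).le)
      exact mul_nonneg (inv_nonneg.2 h5.le) (sub_nonneg.2 h4)
    · have h4 := mem_closedBall_zero_iff.1 (hR h1.2)
      exact (le_abs_self _).trans ((norm_fst_le _).trans h4)
  obtain ⟨s₀, hs₀, hfr⟩ := (isCompact_Icc (a := (0 : ℝ)) (b := R)).ultrafilter_le_nhds (f.map s)
    (by rw [le_principal_iff]; exact hs)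
  have hfr : Tendsto s f (𝓝 s₀) := hfr
  have hv : Tendsto (fun j => (orderStat (n j) (x j) (i j) - u j) / b j) f
      (𝓝 (s₀ * Real.log 2)) := by
    have h1 := (hfr.mul h.tendsto_scale).add h.tendsto_orderStat_self
    rw [add_zero] at h1
    refine h1.congr' ?_
    filter_upwards [h.tendsto_scale.eventually_const_lt hl] with j h3
    have hb := (h.pos j).ne'
    have h5 : orderStat (n j) (x j) ⌈(k j : ℝ) / 2⌉₊ - orderStat (n j) (x j) (k j) ≠ 0 := fun h0 => by
      simp [h0] at h3
    simp only [s]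
    field_simp
    ring
  have hp := h.tendsto_point (by nlinarith [hs₀.1]) hv
  rw [mul_div_cancel_right₀ _ hl.ne'] at hp
  have hmem : (s₀, 1 / Real.log 2) ∈ K :=
    hK.isClosed.mem_of_tendsto hp (hi.mono fun j hj => hj.2)
  have : (s₀, 1 / Real.log 2) ∈ (horizontalHalfLine (1 / Real.log 2) : Set (ℝ × ℝ)) ∩ K :=
    ⟨⟨s₀, hs₀.1, rfl⟩, hmem⟩
  rw [hmiss] at this
  exact this

theorem eventually_hit (h : ExponentialExcesses ℓ n k x u b) {G : Set (ℝ × ℝ)} (hG : IsOpen G)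
    (hhit : ((horizontalHalfLine (1 / Real.log 2) : Set (ℝ × ℝ)) ∩ G).Nonempty) :
    ∀ᶠ j in ℓ, ((mePlot (n j) (k j) (x j) : Set (ℝ × ℝ)) ∩ G).Nonempty := by
  obtain ⟨p, ⟨t, ht, rfl⟩, hpG⟩ := hhit
  have hl := Real.log_pos one_lt_two
  have hy : 0 ≤ t * Real.log 2 := by positivity
  have hp := h.tendsto_point (by linarith) (h.tendsto_orderStat_ceil hy)
  rw [mul_div_cancel_right₀ _ hl.ne'] at hp
  -- The index `⌈2 ^ (-t) * k⌉` must exceed one, since the plot omits the maximum.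
  have hk : Tendsto (fun j => Real.exp (-(t * Real.log 2)) * (k j : ℝ)) ℓ atTop :=
    (tendsto_natCast_atTop_atTop.comp h.tendsto_k).const_mul_atTop (Real.exp_pos _)
  filter_upwards [hp (hG.mem_nhds hpG), hk.eventually_gt_atTop 1] with j h1 h2
  refine ⟨_, ⟨_, ⟨?_, ?_⟩, rfl⟩, h1⟩
  · exact Nat.lt_ceil.2 (by exact_mod_cast h2)
  · refine Nat.ceil_le.2 (mul_le_of_le_one_left (Nat.cast_nonneg _) ?_)
    exact Real.exp_le_one_iff.2 (by linarith)

theorem tendsto_mePlot (h : ExponentialExcesses ℓ n k x u b) :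
    Tendsto (fun j => mePlot (n j) (k j) (x j)) ℓ
      (@nhds _ (fellTopology (ℝ × ℝ)) (horizontalHalfLine (1 / Real.log 2))) := by
  rw [TopologicalSpace.tendsto_nhds_generateFrom_iff]
  rintro _ (⟨K, hK, rfl⟩ | ⟨G, hG, rfl⟩) hmem
  · exact h.eventually_miss hK hmem
  · exact h.eventually_hit hG hmem

end ExponentialExcesses

/-! ### Moments of excesses -/

/-- The excess of `x` over the level `v`. -/
def excess (v x : ℝ) : ℝ := if v < x then x - v else 0

theorem excess_nonneg (v x : ℝ) : 0 ≤ excess v x := by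
  unfold excess
  split_ifs <;> linarith

theorem measurable_excess (v : ℝ) : Measurable (excess v) :=
  Measurable.ite measurableSet_Ioi (by fun_prop) measurable_const

theorem setOf_lt_excess_div {v b t : ℝ} (hb : 0 < b) (ht : 0 ≤ t) :
    {x | t < excess v x / b} = Ioi (v + t * b) := by
  ext x
  rw [mem_ofPred_eq, mem_Ioi, lt_div_iff₀ hb, excess]
  have := mul_nonneg ht hb.le
  split_ifs <;> constructor <;> intro <;> linarith

namespace IsGammaTail

theorem exists_forall_pos {ν : Measure ℝ} {β : ℝ → ℝ} (h : IsGammaTail ν β) :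
    ∃ β', (∀ w, 0 < β' w) ∧ IsGammaTail ν β' := by
  refine ⟨fun w => if 0 < β w then β w else 1, fun w => ?_, ?_, fun x hx => ?_⟩
  · simp only
    split_ifs with h <;> linarith
  · exact h.pos.mono fun w hw => by simp [hw]
  · refine (h.tendsto x hx).congr' ?_
    filter_upwards [h.pos] with w hw
    simp [hw]

variable {ν : Measure ℝ} [IsProbabilityMeasure ν] {β : ℝ → ℝ}

/-- By the layer-cake formula the second moment is twice the integral of `t` times the tail. The
cubic bound leaves the integrable `(1 + t) ^ (-2)`, and `C` does not depend on `z`. -/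
theorem exists_second_moment_bound (h : IsGammaTail ν β) (hβ : ∀ w, 0 < β w) :
    ∃ C, ∀ z, 0 ≤ z → ∀ᶠ w in toLeft (rightEndpoint ν),
      MemLp (fun x => excess (w + z * β w) x / β w) 2 ν ∧
      ∫ x, (excess (w + z * β w) x / β w) ^ 2 ∂ν ≤ C * survival ν w := by
  obtain ⟨C, hC, hP⟩ := h.exists_potter_bound
  have hint : Integrable (fun t : ℝ => (1 + ‖t‖) ^ (-2 : ℝ)) (volume.restrict (Ioi 0)) :=
    (integrable_one_add_norm (by simp)).restrict
  refine ⟨2 * C * ∫ t in Ioi (0 : ℝ), (1 + ‖t‖) ^ (-2 : ℝ), fun z hz => ?_⟩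
  filter_upwards [hP] with w hw
  set f : ℝ → ℝ := fun x => excess (w + z * β w) x / β w with hf
  have hfm : Measurable f := (measurable_excess _).div_const _
  have hf0 : ∀ x, 0 ≤ f x := fun x => div_nonneg (excess_nonneg _ _) (hβ w).le
  have hI0 : 0 ≤ ∫ t in Ioi (0 : ℝ), (1 + ‖t‖) ^ (-2 : ℝ) :=
    integral_nonneg fun t => by positivity
  have hG := survival_nonneg (ν := ν) w
  have hle : ∫⁻ x, ENNReal.ofReal (f x ^ 2) ∂ν ≤
      ENNReal.ofReal (2 * C * (∫ t in Ioi (0 : ℝ), (1 + ‖t‖) ^ (-2 : ℝ)) * survival ν w) := by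
    have h1 := lintegral_rpow_eq_lintegral_meas_lt_mul ν (Eventually.of_forall hf0)
      hfm.aemeasurable (two_pos (α := ℝ))
    simp only [Real.rpow_two] at h1
    rw [h1]
    have h2 : ∫⁻ t in Ioi (0 : ℝ), ν {a | t < f a} * ENNReal.ofReal (t ^ ((2 : ℝ) - 1)) ≤
        ∫⁻ t in Ioi (0 : ℝ), ENNReal.ofReal (C * survival ν w * (1 + ‖t‖) ^ (-2 : ℝ)) := by
      refine setLIntegral_mono' measurableSet_Ioi fun t ht => ?_
      have ht : 0 < t := ht
      rw [hf, setOf_lt_excess_div (hβ w) ht.le, ← ofReal_measureReal,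
        ← ENNReal.ofReal_mul measureReal_nonneg]
      refine ENNReal.ofReal_le_ofReal ?_
      have h3 := hw (z + t) (by positivity)
      rw [show w + (z + t) * β w = w + z * β w + t * β w by ring] at h3
      have h4 : (1 + (z + t)) ^ (-3 : ℝ) ≤ (1 + t) ^ (-3 : ℝ) :=
        Real.rpow_le_rpow_of_nonpos (by positivity) (by linarith) (by norm_num)
      have h5 : (1 + t) ^ (-3 : ℝ) * (1 + t) = (1 + t) ^ (-2 : ℝ) := by
        rw [← Real.rpow_add_one (by positivity)]
        norm_num
      have h6 : 0 ≤ (1 + t) ^ (-3 : ℝ) := by positivity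
      rw [show (2 : ℝ) - 1 = 1 by norm_num, Real.rpow_one, Real.norm_of_nonneg ht.le, ← h5]
      calc survival ν (w + z * β w + t * β w) * t
          ≤ (C * (1 + t) ^ (-3 : ℝ) * survival ν w) * (1 + t) := by
            gcongr
            · exact h3.trans (by gcongr)
            · linarith
        _ = _ := by ring
    rw [← ofReal_integral_eq_lintegral_ofReal (hint.const_mul _)
      (Eventually.of_forall fun t => by positivity), integral_const_mul] at h2
    calc _ ≤ ENNReal.ofReal 2 * ENNReal.ofReal (C * survival ν w *
          ∫ t in Ioi (0 : ℝ), (1 + ‖t‖) ^ (-2 : ℝ)) := by gcongr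
      _ = _ := by
          rw [← ENNReal.ofReal_mul zero_le_two]
          congr 1
          ring
  constructor
  · rw [memLp_two_iff_integrable_sq hfm.aestronglyMeasurable,
      ← lintegral_ofReal_ne_top_iff_integrable (by fun_prop)
        (Eventually.of_forall fun x => sq_nonneg (f x))]
    exact (hle.trans_lt ENNReal.ofReal_lt_top).ne
  · rw [integral_eq_lintegral_of_nonneg_ae (Eventually.of_forall fun x => sq_nonneg (f x))
      (by fun_prop)]
    refine ENNReal.toReal_le_of_le_ofReal (by positivity) hle

/-- The layer-cake formula writes the quotient as an integral of survival ratios. These tend to `exp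
(-(z + t))` and are dominated by the Potter bound. -/
theorem tendsto_mean_excess (h : IsGammaTail ν β) (hβ : ∀ w, 0 < β w) {z : ℝ} (hz : 0 ≤ z) :
    Tendsto (fun w => (∫ x, excess (w + z * β w) x / β w ∂ν) / survival ν w)
      (toLeft (rightEndpoint ν)) (𝓝 (Real.exp (-z))) := by
  obtain ⟨C, hC, hP⟩ := h.exists_potter_bound
  obtain ⟨C', hC'⟩ := h.exists_second_moment_bound hβ
  have hint : Integrable (fun t : ℝ => C * (1 + ‖t‖) ^ (-3 : ℝ)) (volume.restrict (Ioi 0)) :=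
    ((integrable_one_add_norm (by simp)).restrict).const_mul C
  have hlim : ∫ t in Ioi (0 : ℝ), Real.exp (-(z + t)) = Real.exp (-z) := by
    simp only [neg_add, Real.exp_add]
    rw [integral_const_mul, integral_exp_neg_Ioi_zero, mul_one]
  rw [← hlim]
  have hdct : Tendsto (fun w => ∫ t in Ioi (0 : ℝ), survival ν (w + (z + t) * β w) / survival ν w)
      (toLeft (rightEndpoint ν)) (𝓝 (∫ t in Ioi (0 : ℝ), Real.exp (-(z + t)))) := by
    refine tendsto_integral_filter_of_dominated_convergence _ (Eventually.of_forall fun w => ?_)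
      ?_ hint ?_
    · refine Measurable.aestronglyMeasurable ?_
      exact (survival_antitone.measurable.comp (by fun_prop)).div_const _
    · filter_upwards [hP, eventually_survival_pos] with w hw hs
      filter_upwards [ae_restrict_mem measurableSet_Ioi] with t ht
      have ht : 0 < t := ht
      rw [Real.norm_of_nonneg (div_nonneg (survival_nonneg _) hs.le), div_le_iff₀ hs,
        Real.norm_of_nonneg ht.le]
      refine (hw (z + t) (by positivity)).trans ?_
      have h4 : (1 + (z + t)) ^ (-3 : ℝ) ≤ (1 + t) ^ (-3 : ℝ) :=
        Real.rpow_le_rpow_of_nonpos (by positivity) (by linarith) (by norm_num)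
      gcongr
    · filter_upwards [ae_restrict_mem measurableSet_Ioi] with t ht
      have ht : 0 < t := ht
      exact h.tendsto (z + t) (by positivity)
  refine hdct.congr' ?_
  filter_upwards [hC' z hz] with w hw
  rw [(hw.1.integrable one_le_two).integral_eq_integral_meas_lt
    (Eventually.of_forall fun x => div_nonneg (excess_nonneg _ _) (hβ w).le), integral_div]
  congr 1
  refine setIntegral_congr_fun measurableSet_Ioi fun t ht => ?_
  have ht : 0 < t := ht
  rw [setOf_lt_excess_div (hβ w) ht.le, survival]
  congr 2
  ring

end IsGammaTail

/-! ### Convergence in probability as convergence along a filter -/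

section InProb

variable {Ω : Type*} [MeasurableSpace Ω] {μ : Measure Ω}

/-- The filter on `ℕ × Ω` of the events whose probability tends to `1`. -/
def inProb (μ : Measure Ω) : Filter (ℕ × Ω) where
  sets := {A | Tendsto (fun n => μ {ω | (n, ω) ∉ A}) atTop (𝓝 0)}
  univ_sets := by simp
  sets_of_superset := by
    intro A B hA hAB
    refine tendsto_of_tendsto_of_tendsto_of_le_of_le tendsto_const_nhds hA
      (fun n => zero_le) (fun n => measure_mono fun ω hω h => hω (hAB h))
  inter_sets := by
    intro A B hA hB
    have h := Tendsto.add hA hB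
    rw [add_zero] at h
    refine tendsto_of_tendsto_of_tendsto_of_le_of_le tendsto_const_nhds h
      (fun n => zero_le) (fun n => ?_)
    refine (measure_mono fun ω hω => ?_).trans (measure_union_le _ _)
    by_contra hcon
    simp only [mem_union, mem_ofPred_eq, not_or, not_not] at hcon
    exact hω hcon

theorem eventually_inProb {P : ℕ × Ω → Prop} :
    (∀ᶠ p in inProb μ, P p) ↔ Tendsto (fun n => μ {ω | ¬ P (n, ω)}) atTop (𝓝 0) := Iff.rfl

theorem tendsto_fst_inProb : Tendsto Prod.fst (inProb μ) atTop := by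
  intro s hs
  refine tendsto_const_nhds.congr' ?_
  filter_upwards [hs] with n hn
  simp [show n ∈ s from hn]

theorem tendstoInProbability_of_tendsto {T : Type*} {t : TopologicalSpace T} {Y : ℕ → Ω → T} {y : T}
    (h : Tendsto (fun p : ℕ × Ω => Y p.1 p.2) (inProb μ) (𝓝 y)) :
    TendstoInProbability μ t Y y := fun _ hU hy => h (hU.mem_nhds hy)

variable [IsProbabilityMeasure μ] {ν : Measure ℝ} {X : ℕ → Ω → ℝ}

/-- A weak law of large numbers for triangular arrays `f n (X j)`, `j < n`. -/
theorem tendsto_sum_inProb (hX : ∀ i, Measurable (X i)) (hindep : iIndepFun X μ)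
    (hlaw : ∀ i, μ.map (X i) = ν) {f : ℕ → ℝ → ℝ} (hf : ∀ n, Measurable (f n))
    (hL2 : ∀ᶠ n in atTop, MemLp (f n) 2 ν) {m : ℝ}
    (h1 : Tendsto (fun n : ℕ => n * ∫ x, f n x ∂ν) atTop (𝓝 m))
    (h2 : Tendsto (fun n : ℕ => n * ∫ x, f n x ^ 2 ∂ν) atTop (𝓝 0)) :
    Tendsto (fun p : ℕ × Ω => ∑ j ∈ Finset.range p.1, f p.1 (X j p.2)) (inProb μ) (𝓝 m) := by
  rw [Metric.tendsto_nhds]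
  intro ε hε
  rw [eventually_inProb]
  have hlim : Tendsto (fun n : ℕ => ENNReal.ofReal ((n * ∫ x, f n x ^ 2 ∂ν) / (ε / 2) ^ 2)) atTop
      (𝓝 0) := by
    have := ENNReal.tendsto_ofReal (h2.div_const ((ε / 2) ^ 2))
    rwa [zero_div, ENNReal.ofReal_zero] at this
  refine tendsto_of_tendsto_of_tendsto_of_le_of_le' tendsto_const_nhds hlim
    (Eventually.of_forall fun n => zero_le) ?_
  filter_upwards [hL2, Metric.tendsto_nhds.1 h1 (ε / 2) (by positivity)] with n hn hm
  have hmp : ∀ j, MeasurePreserving (X j) μ ν := fun j => ⟨hX j, hlaw j⟩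
  have hY : ∀ j, MemLp (fun ω => f n (X j ω)) 2 μ := fun j => hn.comp_measurePreserving (hmp j)
  have hmean : ∫ ω, (∑ j ∈ Finset.range n, fun ω => f n (X j ω)) ω ∂μ = n * ∫ x, f n x ∂ν := by
    simp only [Finset.sum_apply]
    rw [integral_finsetSum _ fun j _ => (hY j).integrable one_le_two]
    have : ∀ j, ∫ ω, f n (X j ω) ∂μ = ∫ x, f n x ∂ν := fun j => by
      rw [← hlaw j, integral_map (hX j).aemeasurable (hf n).aestronglyMeasurable]
    simp [this]
  have hvar : Var[∑ j ∈ Finset.range n, fun ω => f n (X j ω); μ] ≤ n * ∫ x, f n x ^ 2 ∂ν := by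
    rw [IndepFun.variance_sum (fun j _ => hY j)
      (fun i _ j _ hij => (hindep.indepFun hij).comp (hf n) (hf n))]
    have : ∀ j, Var[fun ω => f n (X j ω); μ] ≤ ∫ x, f n x ^ 2 ∂ν := fun j => by
      refine (variance_le_expectation_sq (hY j).aestronglyMeasurable).trans_eq ?_
      rw [← hlaw j, integral_map (hX j).aemeasurable ((hf n).pow_const 2).aestronglyMeasurable]
      rfl
    refine (Finset.sum_le_sum fun j _ => this j).trans_eq ?_
    simp
  -- Half of `ε` goes to the fluctuation, half to the distance of the mean from `m`.
  have hcheb := meas_ge_le_variance_div_sq (memLp_finsetSum' (Finset.range n) fun j _ => hY j)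
    (half_pos hε)
  rw [hmean] at hcheb
  refine (measure_mono fun ω hω => ?_).trans
    (hcheb.trans (ENNReal.ofReal_le_ofReal (by gcongr)))
  simp only [mem_ofPred_eq, not_lt, Finset.sum_apply] at hω ⊢
  rw [Real.dist_eq] at hω hm
  have := abs_sub_le (∑ j ∈ Finset.range n, f n (X j ω)) (n * ∫ x, f n x ∂ν) m
  linarith

/-- The law of large numbers for sums over exceedances of an intermediate sequence of levels. -/
theorem tendsto_sum_div_inProb (hX : ∀ i, Measurable (X i)) (hindep : iIndepFun X μ)
    (hlaw : ∀ i, μ.map (X i) = ν) {k : ℕ → ℕ} (hk : Tendsto k atTop atTop) {G : ℕ → ℝ} {τ : ℝ}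
    (hG : Tendsto (fun n : ℕ => n / k n * G n) atTop (𝓝 τ))
    {g : ℕ → ℝ → ℝ} (hg : ∀ n, Measurable (g n)) (hL2 : ∀ᶠ n in atTop, MemLp (g n) 2 ν) {C a : ℝ}
    (hsq : ∀ᶠ n in atTop, ∫ x, g n x ^ 2 ∂ν ≤ C * G n)
    (hG0 : ∀ᶠ n in atTop, 0 < G n)
    (hmean : Tendsto (fun n => (∫ x, g n x ∂ν) / G n) atTop (𝓝 a)) :
    Tendsto (fun p : ℕ × Ω => (∑ j ∈ Finset.range p.1, g p.1 (X j p.2)) / k p.1) (inProb μ)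
      (𝓝 (τ * a)) := by
  simp only [Finset.sum_div]
  refine tendsto_sum_inProb (f := fun n x => g n x / k n) hX hindep hlaw
    (fun n => (hg n).div_const _) ?_ ?_ ?_
  · filter_upwards [hL2] with n hn
    simpa only [div_eq_mul_inv] using hn.mul_const _
  · refine (hG.mul hmean).congr' ?_
    filter_upwards [hG0] with n hn
    rw [integral_div]
    field_simp
  -- Dividing by `k` squared leaves a bounded quantity times `1 / k`; this is where `k → ∞` is
  -- needed.
  · have hk' : Tendsto (fun n => ((k n : ℝ))⁻¹) atTop (𝓝 0) :=
      tendsto_inv_atTop_zero.comp (tendsto_natCast_atTop_atTop.comp hk)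
    have h0 := (hG.const_mul C).mul hk'
    rw [mul_zero] at h0
    refine tendsto_of_tendsto_of_tendsto_of_le_of_le' tendsto_const_nhds h0
      (Eventually.of_forall fun n => mul_nonneg (Nat.cast_nonneg _)
        (integral_nonneg fun x => sq_nonneg _)) ?_
    filter_upwards [hsq] with n hn
    simp only [div_pow]
    rw [integral_div]
    calc (n : ℝ) * ((∫ x, g n x ^ 2 ∂ν) / (k n : ℝ) ^ 2)
        ≤ n * ((C * G n) / (k n : ℝ) ^ 2) := by gcongr
      _ = C * (n / k n * G n) * (k n : ℝ)⁻¹ := by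
        rw [pow_two, div_eq_mul_inv, div_eq_mul_inv, mul_inv]
        ring

theorem IsGammaTail.exponentialExcesses [IsProbabilityMeasure ν] {β : ℝ → ℝ} (h : IsGammaTail ν β) (hβ : ∀ w, 0 < β w)
    (hX : ∀ i, Measurable (X i)) (hindep : iIndepFun X μ) (hlaw : ∀ i, μ.map (X i) = ν)
    {k : ℕ → ℕ} (hk : Tendsto k atTop atTop)
    (hkn : Tendsto (fun n => (k n : ℝ) / n) atTop (𝓝 0)) :
    ∃ u b : ℕ → ℝ, ExponentialExcesses (inProb μ) (fun p => p.1) (fun p => k p.1)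
      (fun p i => X i p.2) (fun p => u p.1) (fun p => b p.1) := by
  have hpos : ∀ᶠ n in atTop, 0 < (k n : ℝ) ∧ 0 < (n : ℝ) := by
    filter_upwards [hk.eventually_ge_atTop 1, eventually_ge_atTop 1] with n h1 h2
    exact ⟨by positivity, by positivity⟩
  have hp := hkn.const_mul (Real.exp 1)
  rw [mul_zero] at hp
  -- The level `v` is exceeded about `exp 1 * k` times. The base level `v + β v` is then exceeded
  -- about `k` times, and heights `y ≥ -1` over it are nonnegative shifts `1 + y` of `v`. Room below
  -- `y = 0` is needed since `X_(k)` may fall below the base level.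
  obtain ⟨v, hvL, hv⟩ := h.exists_levels (p := fun n : ℕ => Real.exp 1 * ((k n : ℝ) / n))
    (hpos.mono fun n hn => mul_pos (Real.exp_pos _) (div_pos hn.1 hn.2)) hp
  have hG : Tendsto (fun n : ℕ => n / k n * survival ν (v n)) atTop (𝓝 (Real.exp 1)) := by
    have h1 := hv.const_mul (Real.exp 1)
    rw [mul_one] at h1
    refine h1.congr' ?_
    filter_upwards [hpos] with n hn
    have := hn.1
    have := hn.2
    field_simp
  have hG0 := hvL.eventually eventually_survival_pos
  have hexp : ∀ y, Real.exp (-y) = Real.exp 1 * Real.exp (-(1 + y)) := fun y => by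
    rw [← Real.exp_add]
    congr 1
    ring
  refine ⟨fun n => v n + β (v n), fun n => β (v n), fun p => hβ _, ?_, hk.comp tendsto_fst_inProb,
    fun y hy => ?_, fun y hy => ?_⟩
  · refine tendsto_fst_inProb.eventually (p := fun n => k n ≤ n) ?_
    filter_upwards [hkn.eventually_lt_const zero_lt_one, hpos] with n h1 h2
    rw [div_lt_one h2.2] at h1
    exact_mod_cast h1.le
  · rw [hexp]
    have hms : ∀ n, MeasurableSet (Ioi (v n + (1 + y) * β (v n))) := fun n => measurableSet_Ioi
    have hint : ∀ n, ∫ x, (Ioi (v n + (1 + y) * β (v n))).indicator (fun _ => (1 : ℝ)) x ∂ν =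
        survival ν (v n + (1 + y) * β (v n)) := fun n => by
      rw [integral_indicator_const _ (hms n), smul_eq_mul, mul_one, survival]
    refine (tendsto_sum_div_inProb hX hindep hlaw hk hG (C := 1)
      (g := fun n => (Ioi (v n + (1 + y) * β (v n))).indicator fun _ => (1 : ℝ))
      (fun n => measurable_const.indicator (hms n))
      (Eventually.of_forall fun n => memLp_indicator_const 2 (hms n) 1 (Or.inr (measure_ne_top _ _)))
      (Eventually.of_forall fun n => ?_) hG0 ?_).congr fun p => ?_
    · have : ∀ x, (Ioi (v n + (1 + y) * β (v n))).indicator (fun _ => (1 : ℝ)) x ^ 2 =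
          (Ioi (v n + (1 + y) * β (v n))).indicator (fun _ => (1 : ℝ)) x := fun x => by
        by_cases hx : x ∈ Ioi (v n + (1 + y) * β (v n)) <;> simp [hx]
      simp only [this]
      rw [hint, one_mul]
      refine survival_antitone ?_
      have := mul_nonneg (show 0 ≤ 1 + y by linarith) (hβ (v n)).le
      linarith
    · simp only [hint]
      exact (h.tendsto (1 + y) (by linarith)).comp hvL
    · rw [exceedances]
      congr 1
      refine Finset.sum_congr rfl fun j _ => ?_
      rw [indicator_apply]
      simp only [mem_Ioi]
      rw [show v p.1 + β (v p.1) + y * β (v p.1) = v p.1 + (1 + y) * β (v p.1) by ring]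
  · rw [hexp]
    obtain ⟨C, hC⟩ := h.exists_second_moment_bound hβ
    have hC := hvL.eventually (hC (1 + y) (by linarith))
    refine (tendsto_sum_div_inProb hX hindep hlaw hk hG (C := C)
      (g := fun n x => excess (v n + (1 + y) * β (v n)) x / β (v n))
      (fun n => (measurable_excess _).div_const _) (hC.mono fun n hn => hn.1)
      (hC.mono fun n hn => hn.2) hG0
      ((h.tendsto_mean_excess hβ (by linarith)).comp hvL)).congr fun p => ?_
    rw [totalExcess, ← Finset.sum_div, div_div, mul_comm (β _)]
    congr 1
    refine Finset.sum_congr rfl fun j _ => ?_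
    rw [excess,
      show v p.1 + β (v p.1) + y * β (v p.1) = v p.1 + (1 + y) * β (v p.1) by ring]

end InProb

end

end MeanExcess

theorem theorem3p7 {Ω : Type*} [MeasurableSpace Ω] (μ : Measure Ω) [IsProbabilityMeasure μ]
    (ν : Measure ℝ) [IsProbabilityMeasure ν]
    (X : ℕ → Ω → ℝ) (hX : ∀ i, Measurable (X i)) (hindep : iIndepFun X μ)
    (hlaw : ∀ i, μ.map (X i) = ν)
    (hF : MeanExcess.HasVonMisesRepresentation ν ∨ MeanExcess.InGumbelMaxDomain ν ∨
      MeanExcess.HasGPDZeroApproximation ν)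
    (k : ℕ → ℕ) (hk : Tendsto k atTop atTop)
    (hkn : Tendsto (fun n => (k n : ℝ) / n) atTop (𝓝 0)) :
    MeanExcess.TendstoInProbability μ (MeanExcess.fellTopology (ℝ × ℝ))
      (fun n ω => MeanExcess.mePlot n (k n) (fun i => X i ω))
      (MeanExcess.horizontalHalfLine (1 / Real.log 2)) := by
  have hΓ : ∃ β, MeanExcess.IsGammaTail ν β :=
    hF.elim (fun h => h.isGammaTail) fun h => h.elim (fun h => h.isGammaTail)
      fun h => h.isGammaTail
  obtain ⟨β₀, h₀⟩ := hΓ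
  obtain ⟨β, hβ, h⟩ := h₀.exists_forall_pos
  obtain ⟨u, b, hub⟩ := h.exponentialExcesses hβ hX hindep hlaw hk hkn
  exact MeanExcess.tendstoInProbability_of_tendsto hub.tendsto_mePlot
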